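/- \textbf{Setting.} Consider the mixed-binary linear program $$\text{(MBLP)}\qquad \min\{f(u)=c^\top x+d^\top y : u=(x,y)\in\mathcal S\},\qquad \mathcal S=\{(x,y)\in\mathcal K : x\in\{0,1\}^n\},$$ with $\mathcal K=\{(x,y)\in[0,1]^n\times[0,\bar y] : Ax+By\le b\}$, $\bar y\ge 0$ ($\mathcal K$ or $\mathcal S$ may be empty). Let $p(u)=\sum_i\min\{x_i,1-x_i\}$ and, for a point $w=(\hat x,\hat y)$, $l_w(u)=\sum_{i:\hat x_i\le 1/2}x_i+\sum_{i:\hat x_i>1/2}(1-x_i)$. For a polytope $K$ let $V(K)$ be its vertex set. A real number $t$ is called large enough for $K$ if $f(a)-f(b)<t\,(l_w(w)-l_w(v))$ for all $a,v\in V(K)$ and all $b,w\in V(K)$ with non-binary $x$-part such that $l_w(v)<l_w(w)$ (that is, $t>M/\sigma$ with $M=\max_{V(K)}f-\min\{f(b):b\in V(K)\text{ non-binary}\}$ and $\sigma=\min\{l_w(w)-l_w(v)\}$). \textbf{The DCCUT algorithm} (parameters $t>0$, $\varepsilon>0$). Start with $\mathcal K^0=\mathcal K$, $\mathcal S^0=\mathcal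 S$, $\mathrm{UB}=+\infty$, $\mathrm{LB}=-\infty$, $u_{opt}=\mathrm{null}$. While $\mathrm{UB}-\mathrm{LB}\ge\varepsilon$, do the following for $k=0,1,\dots$: (1) If $\mathcal K^k=\emptyset$, return. Otherwise take a vertex $u^0$ of $\mathcal K^k$ minimizing $f$ over $\mathcal K^k$ and set $\mathrm{LB}\leftarrow\max\{\mathrm{LB},f(u^0)\}$. (2) If $u^0\in\mathcal S^k$, then, if $f(u^0)<\mathrm{UB}$, set $\mathrm{UB}\leftarrow f(u^0)$, $u_{opt}\leftarrow u^0$; return. (3) Otherwise apply DCA from $u^0$ to the DC program $\min\{\chi_{\mathcal K^k}-h\}$, $h=-f-tp$ (repeatedly choose $v\in\partial h(z)$ and replace $z$ by a vertex of $\mathcal K^k$ minimizing $-\langle v,\cdot\rangle$ over $\mathcal K^k$), to get a critical point $u^*$, and add classical global cuts at $u^0$. (4) If $u^*\in\mathcal S^k$, add the type-I DC cut $l_{u^*}(u)\ge 1$ and, if $f(u^*)<\mathrm{UB}$, set $\mathrm{UB}\leftarrow f(u^*)$, $u_{opt}\leftarrow u^*$. If $u^*\notin\mathcal S^k$, $p(u^*)\notin\mathbb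 Z$ and no $x_i^*$ equals $\frac12$, add the type-II DC cut $l_{u^*}(u)\ge\lceil l_{u^*}(u^*)\rceil$. In the remaining case, add classical global cuts at $u^*$. (5) $\mathcal K^{k+1}$ and $\mathcal S^{k+1}$ are the subsets of $\mathcal K^k$ and $\mathcal S^k$ satisfying all cuts added in this iteration. \textbf{Lift-and-Project (L\&P) cuts.} For a system of inequalities $\widetilde A u\ge\beta$ with columns $a_i$ and an index $j\in\{1,\dots,n\}$, an L\&P cut at $\hat u$ is $(w^\top D_j+v^\top \widetilde C_j)u\ge v^\top\beta$, where $D_j$ is zero except for its column $j$, which is $a_j-\beta$, $\widetilde C_j=\widetilde A-D_j$, and $(w,v)$ is a basic optimal solution of the problem of maximizing $v^\top\beta-(w^\top D_j+v^\top\widetilde C_j)\hat u$ subject to $w,v\ge0$, $w^\top a_i=v^\top a_i$ for all columns $i\ne j$, $\sum w+\sum v=1$. In the Balas--Ceria--Cornu\'ejols L\&P rule, the cuts generated at $\hat u$ are one or several L\&P cuts for indices $j$ with $\hat x_j$ fractional, among them one for the largest such $j$; the cut for index $j$ is generated from the constraints of $\mathcal K$, the DC cuts, and the L\&P cuts for indices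 smaller than $j$ introduced in earlier iterations. \textbf{Theorem (Convergence of the DCCUT algorithm).} (a) Let the classical global cuts be any finite sets of linear inequalities valid for the current set $\mathcal S^k$. If a run of DCCUT stops, and $t$ is large enough for the sets $\mathcal K^k$ of all its completed iterations, then one of the following three cases holds: it stops because $\mathcal K^k=\emptyset$ with $u_{opt}=\mathrm{null}$, and (MBLP) is infeasible; or it stops because $\mathcal K^k=\emptyset$ or $u^0\in\mathcal S^k$, and $u_{opt}$ is an exact global optimal solution of (MBLP); or it stops because $\mathrm{UB}-\mathrm{LB}<\varepsilon$, and $u_{opt}\in\mathcal S$, $f(u_{opt})=\mathrm{UB}$ and $f(u_{opt})<f(v)+\varepsilon$ for all $v\in\mathcal S$. (b) If the classical global cuts are L\&P cuts generated by the Balas--Ceria--Cornu\'ejols rule, then these cuts are valid for $\mathcal S^k$, and, for all $t>0$ and $\varepsilon>0$, DCCUT converges: it can never be blocked (as long as it has not stopped, an iteration can be carried out), each call of DCA reaches a critical point after finitely many DCA iterations, and every run stops after finitely many iterations. Moreover there is a finite $T\ge0$, depending only on (MBLP), such that every $t>T$ is large enough for all sets $\mathcal K^k$ of all runs; hence for $t>T$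 every run terminates in one of the three cases of (a). -/

import Mathlib

open scoped Matrix

namespace DCCUT

/-! ### Mixed-binary linear programs -/

/-- Points `u = (x, y)`: `u (Sum.inl i)` is the variable `x i` (required to be binary),
`u (Sum.inr j)` is the continuous variable `y j`. -/
abbrev Pt (n q : ℕ) : Type := Fin n ⊕ Fin q → ℝ

/-- Data of the program: minimize `c x + d y` subject to `A x + B y ≤ b`, `x ∈ {0,1}ⁿ`,
`y ∈ [0, ybar]`. -/
structure MBLP (n q m : ℕ) where
  c : Fin n → ℝ
  d : Fin q → ℝ
  A : Matrix (Fin m) (Fin n) ℝ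
  B : Matrix (Fin m) (Fin q) ℝ
  b : Fin m → ℝ
  ybar : Fin q → ℝ
  ybar_nonneg : ∀ j, 0 ≤ ybar j

/-- All variables `x i` are `0` or `1`. -/
def Binary {n q : ℕ} (u : Pt n q) : Prop :=
  ∀ i : Fin n, u (Sum.inl i) = 0 ∨ u (Sum.inl i) = 1

/-- The objective `f (x, y) = c x + d y`. -/
def MBLP.f {n q m : ℕ} (P : MBLP n q m) (u : Pt n q) : ℝ :=
  P.c ⬝ᵥ (u ∘ Sum.inl) + P.d ⬝ᵥ (u ∘ Sum.inr)

/-- The polytope `𝒦` of the linear relaxation. -/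
def MBLP.K {n q m : ℕ} (P : MBLP n q m) : Set (Pt n q) :=
  {u | (∀ i : Fin n, 0 ≤ u (Sum.inl i) ∧ u (Sum.inl i) ≤ 1) ∧
       (∀ j : Fin q, 0 ≤ u (Sum.inr j) ∧ u (Sum.inr j) ≤ P.ybar j) ∧
       ∀ k : Fin m, (P.A *ᵥ (u ∘ Sum.inl)) k + (P.B *ᵥ (u ∘ Sum.inr)) k ≤ P.b k}

/-- The set `𝒮` of feasible solutions. -/
def MBLP.S {n q m : ℕ} (P : MBLP n q m) : Set (Pt n q) :=
  {u | u ∈ P.K ∧ Binary u}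

/-- `u` is a global optimal solution. -/
def MBLP.IsOptimal {n q m : ℕ} (P : MBLP n q m) (u : Pt n q) : Prop :=
  u ∈ P.S ∧ ∀ v ∈ P.S, P.f u ≤ P.f v

/-! ### Linear inequalities, cuts, and reduced sets -/

/-- The linear inequality `a u ≥ β`. -/
structure Ineq (n q : ℕ) where
  a : Pt n q
  β : ℝ

def Ineq.Sat {n q : ℕ} (r : Ineq n q) (u : Pt n q) : Prop := r.β ≤ r.a ⬝ᵥ u

/-- A cutting plane.  The `level` is bookkeeping for lift-and-project cuts: it is `j + 1` for a
lift-and-project cut generated from the variable `x j` with `j : Fin n`, and `0` for a DC cut. -/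
structure Cut (n q : ℕ) where
  level : ℕ
  ineq : Ineq n q

/-- The reduced set `𝒦ᵏ`, where `C` is the set of all cuts introduced so far. -/
def MBLP.Kk {n q m : ℕ} (P : MBLP n q m) (C : Finset (Cut n q)) : Set (Pt n q) :=
  {u | u ∈ P.K ∧ ∀ c ∈ C, c.ineq.Sat u}

/-- The reduced set `𝒮ᵏ`. -/
def MBLP.Sk {n q m : ℕ} (P : MBLP n q m) (C : Finset (Cut n q)) : Set (Pt n q) :=
  {u | u ∈ P.S ∧ ∀ c ∈ C, c.ineq.Sat u}

open Classical in
/-- The constraints that define `𝒦`, all written in the form `a u ≥ β`. -/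
noncomputable def MBLP.baseRows {n q m : ℕ} (P : MBLP n q m) : Finset (Ineq n q) :=
  Finset.univ.image
      (fun k : Fin m => (⟨Sum.elim (fun i => -P.A k i) (fun j => -P.B k j), -P.b k⟩ : Ineq n q))
    ∪ Finset.univ.image (fun i : Fin n ⊕ Fin q => (⟨Pi.single i 1, 0⟩ : Ineq n q))
    ∪ Finset.univ.image (fun i : Fin n => (⟨Pi.single (Sum.inl i) (-1), -1⟩ : Ineq n q))
    ∪ Finset.univ.image (fun j : Fin q => (⟨Pi.single (Sum.inr j) (-1), -P.ybar j⟩ : Ineq n q))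

theorem MBLP.mem_K_iff_baseRows {n q m : ℕ} (P : MBLP n q m) (u : Pt n q) :
    u ∈ P.K ↔ ∀ r ∈ P.baseRows, r.Sat u := by
  classical
  have key : ∀ k : Fin m,
      (Sum.elim (fun i => -P.A k i) (fun j => -P.B k j) : Pt n q) ⬝ᵥ u
        = -((P.A *ᵥ (u ∘ Sum.inl)) k + (P.B *ᵥ (u ∘ Sum.inr)) k) := by
    intro k
    simp [dotProduct, Matrix.mulVec, Fintype.sum_sum_type, Finset.sum_neg_distrib]
    ring
  constructor
  · rintro ⟨hx, hy, hA⟩ r hr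
    simp only [MBLP.baseRows, Finset.mem_union, Finset.mem_image, Finset.mem_univ, true_and] at hr
    rcases hr with ((⟨k, rfl⟩ | ⟨i, rfl⟩) | ⟨i, rfl⟩) | ⟨j, rfl⟩
    · have := hA k
      simp only [Ineq.Sat, key]; linarith
    · rcases i with i | j
      · simpa [Ineq.Sat] using (hx i).1
      · simpa [Ineq.Sat] using (hy j).1
    · simpa [Ineq.Sat] using (hx i).2
    · simpa [Ineq.Sat] using (hy j).2
  · intro h
    simp only [MBLP.baseRows, Finset.mem_union, Finset.mem_image, Finset.mem_univ, true_and] at h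
    refine ⟨fun i => ⟨?_, ?_⟩, fun j => ⟨?_, ?_⟩, fun k => ?_⟩
    · simpa [Ineq.Sat] using h _ (Or.inl (Or.inl (Or.inr ⟨Sum.inl i, rfl⟩)))
    · simpa [Ineq.Sat] using h _ (Or.inl (Or.inr ⟨i, rfl⟩))
    · simpa [Ineq.Sat] using h _ (Or.inl (Or.inl (Or.inr ⟨Sum.inr j, rfl⟩)))
    · simpa [Ineq.Sat] using h _ (Or.inr ⟨j, rfl⟩)
    · have := h _ (Or.inl (Or.inl (Or.inl ⟨k, rfl⟩)))
      simp only [Ineq.Sat, key] at this; linarith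

/-! ### The penalized problem `min {f + t p : u ∈ 𝒦ᵏ}` and DCA -/

/-- The penalty function `p (x) = ∑ min (x i, 1 - x i)`. -/
noncomputable def penalty {n q : ℕ} (u : Pt n q) : ℝ :=
  ∑ i : Fin n, min (u (Sum.inl i)) (1 - u (Sum.inl i))

/-- The convex function `h = - f - t p` of the DC decomposition `χ_K - h` of the penalized
problem over `K`. -/
noncomputable def MBLP.h {n q m : ℕ} (P : MBLP n q m) (t : ℝ) (u : Pt n q) : ℝ :=
  -P.f u - t * penalty u

/-- The subdifferential of a real-valued function. -/
def subdiff {n q : ℕ} (φ : Pt n q → ℝ) (u : Pt n q) : Set (Pt n q) :=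
  {v | ∀ z, φ u + v ⬝ᵥ (z - u) ≤ φ z}

/-- The normal cone of `K` (empty outside `K`), i.e. the subdifferential of the indicator
function of `K`. -/
def normalCone {n q : ℕ} (K : Set (Pt n q)) (u : Pt n q) : Set (Pt n q) :=
  {v | u ∈ K ∧ ∀ z ∈ K, v ⬝ᵥ (z - u) ≤ 0}

/-- Critical points of the DC program `min (χ_K - h)`. -/
def MBLP.IsCritical {n q m : ℕ} (P : MBLP n q m) (t : ℝ) (K : Set (Pt n q)) (u : Pt n q) : Prop :=
  (normalCone K u ∩ subdiff (P.h t) u).Nonempty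

/-- One iteration of DCA over `K`: choose a subgradient `v` of `h` at `z`, then take a vertex
solution `z'` of the linear program `min {- v u : u ∈ K}`. -/
def MBLP.DCAStep {n q m : ℕ} (P : MBLP n q m) (t : ℝ) (K : Set (Pt n q)) (z z' : Pt n q) : Prop :=
  ∃ v ∈ subdiff (P.h t) z, z' ∈ K.extremePoints ℝ ∧ ∀ u ∈ K, -(v ⬝ᵥ z') ≤ -(v ⬝ᵥ u)

/-- `u` is a critical point reached by finitely many DCA iterations from `u₀`. -/
def MBLP.DCAOutput {n q m : ℕ} (P : MBLP n q m) (t : ℝ) (K : Set (Pt n q)) (u₀ u : Pt n q) :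
    Prop :=
  Relation.ReflTransGen (P.DCAStep t K) u₀ u ∧ P.IsCritical t K u

/-! ### DC cuts -/

/-- The affine function `l_w (u) = ∑_{i : w i ≤ 1/2} x i + ∑_{i : w i > 1/2} (1 - x i)`. -/
noncomputable def ell {n q : ℕ} (w u : Pt n q) : ℝ :=
  ∑ i : Fin n, if w (Sum.inl i) ≤ 1 / 2 then u (Sum.inl i) else 1 - u (Sum.inl i)

/-- The inequality `l_w (u) ≥ r`, as a linear inequality in `u`. -/
noncomputable def dcIneq {n q : ℕ} (w : Pt n q) (r : ℝ) : Ineq n q where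
  a := Sum.elim (fun i => if w (Sum.inl i) ≤ 1 / 2 then 1 else -1) (fun _ => 0)
  β := r - ∑ i : Fin n, if w (Sum.inl i) ≤ 1 / 2 then 0 else 1

theorem dcIneq_sat {n q : ℕ} (w u : Pt n q) (r : ℝ) : (dcIneq w r).Sat u ↔ r ≤ ell w u := by
  have : ell w u = (dcIneq w r).a ⬝ᵥ u
      + ∑ i : Fin n, (if w (Sum.inl i) ≤ 1 / 2 then (0 : ℝ) else 1) := by
    simp only [ell, dcIneq, dotProduct, Fintype.sum_sum_type, Sum.elim_inl, Sum.elim_inr, zero_mul,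
      Finset.sum_const_zero, add_zero, ← Finset.sum_add_distrib]
    refine Finset.sum_congr rfl fun i _ => ?_
    split_ifs <;> ring
  rw [this]
  simp only [Ineq.Sat, dcIneq]
  constructor <;> intro h <;> linarith

/-- The type-I DC cut at `w`: `l_w (u) ≥ 1`. -/
noncomputable def typeI {n q : ℕ} (w : Pt n q) : Cut n q := ⟨0, dcIneq w 1⟩

/-- The type-II DC cut at `w`: `l_w (u) ≥ ⌈l_w (w)⌉`. -/
noncomputable def typeII {n q : ℕ} (w : Pt n q) : Cut n q := ⟨0, dcIneq w ⌈ell w w⌉⟩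

/-- The condition under which a type-II DC cut is introduced at an infeasible point `u`:
`p (u) ∉ ℤ` and no `x i` equals `1/2`. -/
def DCConstructible {n q : ℕ} (u : Pt n q) : Prop :=
  (¬ ∃ z : ℤ, penalty u = z) ∧ ∀ i : Fin n, u (Sum.inl i) ≠ 1 / 2

/-- The penalty parameter is large enough for `K`: `t > M / σ`, where
`M = max {f a : a ∈ V(K)} - min {f b : b ∈ V(K), b not binary}` and
`σ = min {l_w (w) - l_w (v) : w, v ∈ V(K), w not binary, l_w (v) < l_w (w)}`
(no condition if one of these sets is empty). -/
def MBLP.LargePenalty {n q m : ℕ} (P : MBLP n q m) (t : ℝ) (K : Set (Pt n q)) : Prop :=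
  ∀ w ∈ K.extremePoints ℝ, ¬ Binary w → ∀ v ∈ K.extremePoints ℝ, ell w v < ell w w →
    ∀ a ∈ K.extremePoints ℝ, ∀ b ∈ K.extremePoints ℝ, ¬ Binary b →
      P.f a - P.f b < t * (ell w w - ell w v)

/-! ### Classical global cuts, lift-and-project cuts -/

/-- A rule for generating classical global cuts: `G C u V` says that, when the cuts introduced so
far are `C`, the finite set `V` of cuts may be generated at the point `u`. -/
abbrev CutRule (n q : ℕ) : Type := Finset (Cut n q) → Pt n q → Finset (Cut n q) → Prop

/-- The rule only generates inequalities which are valid for the current feasible set `𝒮ᵏ`. -/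
def MBLP.IsGlobalCutRule {n q m : ℕ} (P : MBLP n q m) (G : CutRule n q) : Prop :=
  ∀ C u V, G C u V → ∀ c ∈ V, ∀ z ∈ P.Sk C, c.ineq.Sat z

/-- The feasible multipliers `(w, v)` of the cut generating linear program for the system `R` of
inequalities `a u ≥ β` and the variable `x j`: `w, v ≥ 0`, `w C_j = v C_j`, where `C_j` is the
coefficient matrix of `R` without the column of `x j`, normalized by `∑ w + ∑ v = 1`. -/
def lpMultipliers {n q : ℕ} (R : Finset (Ineq n q)) (j : Fin n) : Set ((R → ℝ) × (R → ℝ)) :=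
  {wv | (∀ r, 0 ≤ wv.1 r) ∧ (∀ r, 0 ≤ wv.2 r) ∧
        (∀ i : Fin n ⊕ Fin q, i ≠ Sum.inl j →
          ∑ r, wv.1 r * r.1.a i = ∑ r, wv.2 r * r.1.a i) ∧
        ∑ r, wv.1 r + ∑ r, wv.2 r = 1}

open Classical in
/-- The inequality `(w D_j + v C'_j) u ≥ v β`, where `D_j` is zero except for its column `j`, which
is `a_j - β`, and `C'_j` is the coefficient matrix with its column `j` replaced by `β`. -/
noncomputable def lpIneq {n q : ℕ} (R : Finset (Ineq n q)) (j : Fin n) (wv : (R → ℝ) × (R → ℝ)) :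
    Ineq n q where
  a := fun i =>
    if i = Sum.inl j then
      ∑ r, (wv.1 r * (r.1.a (Sum.inl j) - r.1.β) + wv.2 r * r.1.β)
    else ∑ r, wv.2 r * r.1.a i
  β := ∑ r, wv.2 r * r.1.β

/-- `r` is a lift-and-project cut at `u` for the system `R` and the variable `x j`: it comes from a
basic optimal solution of the linear program maximizing the violation at `u`. -/
def IsLPCut {n q : ℕ} (R : Finset (Ineq n q)) (j : Fin n) (u : Pt n q) (r : Ineq n q) : Prop :=
  ∃ wv ∈ (lpMultipliers R j).extremePoints ℝ,
    (∀ wv' ∈ lpMultipliers R j,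
      (lpIneq R j wv').β - (lpIneq R j wv').a ⬝ᵥ u ≤ (lpIneq R j wv).β - (lpIneq R j wv).a ⬝ᵥ u) ∧
    r = lpIneq R j wv

/-- `x j` is fractional at `u`. -/
def Fractional {n q : ℕ} (u : Pt n q) (j : Fin n) : Prop :=
  u (Sum.inl j) ≠ 0 ∧ u (Sum.inl j) ≠ 1

open Classical in
/-- The system used for the variable `x j`: the constraints of `𝒦`, the DC cuts, and the
lift-and-project cuts generated from variables of smaller index. -/
noncomputable def MBLP.rows {n q m : ℕ} (P : MBLP n q m) (C : Finset (Cut n q)) (j : Fin n) :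
    Finset (Ineq n q) :=
  P.baseRows ∪ (C.filter fun c => c.level ≤ (j : ℕ)).image Cut.ineq

/-- The lift-and-project rule of Balas, Ceria and Cornuéjols: at `u`, generate one or several
lift-and-project cuts from fractional variables, among them one from the fractional variable of
largest index; the cut from `x j` is derived from the system `P.rows C j`. -/
def MBLP.liftProject {n q m : ℕ} (P : MBLP n q m) : CutRule n q := fun C u V =>
  (∀ c ∈ V, ∃ j : Fin n, c.level = (j : ℕ) + 1 ∧ Fractional u j ∧
      IsLPCut (P.rows C j) j u c.ineq) ∧
  ∃ j : Fin n, Fractional u j ∧ (∀ i, j < i → ¬ Fractional u i) ∧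
    ∃ c ∈ V, c.level = (j : ℕ) + 1

/-! ### The DCCUT algorithm -/

/-- The values of the program variables at the beginning of an iteration; `cuts` is the set of
all cuts introduced so far, and `none` stands for `null`. -/
structure State (n q : ℕ) where
  cuts : Finset (Cut n q)
  UB : EReal
  LB : EReal
  uopt : Option (Pt n q)
  fopt : Option ℝ

/-- The state at the beginning. -/
noncomputable def start (n q : ℕ) : State n q := ⟨∅, ⊤, ⊥, none, none⟩

/-- Update of the lower bound by the value of a solution `u₀` of the linear relaxation. -/
noncomputable def MBLP.updateLB {n q m : ℕ} (P : MBLP n q m) (s : State n q) (u₀ : Pt n q) :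
    State n q :=
  { s with LB := max s.LB (P.f u₀ : EReal) }

open Classical in
/-- Update of the upper bound and of the best solution, if `u` is better. -/
noncomputable def MBLP.updateUB {n q m : ℕ} (P : MBLP n q m) (s : State n q) (u : Pt n q) :
    State n q :=
  if (P.f u : EReal) < s.UB then
    { s with UB := (P.f u : EReal), uopt := some u, fopt := some (P.f u) }
  else s

/-- `u₀` is a vertex solution of the linear relaxation `min {f u : u ∈ 𝒦ᵏ}`. -/
def MBLP.SolvesRelaxation {n q m : ℕ} (P : MBLP n q m) (C : Finset (Cut n q)) (u₀ : Pt n q) :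
    Prop :=
  u₀ ∈ (P.Kk C).extremePoints ℝ ∧ ∀ u ∈ P.Kk C, P.f u₀ ≤ P.f u

/-- The treatment of the critical point `u` found by DCA, in the state `s`: the new values of the
variables, and the cuts added at `u`. -/
inductive MBLP.CutsAtCritical {n q m : ℕ} (P : MBLP n q m) (G : CutRule n q) (s : State n q)
    (u : Pt n q) : State n q → Finset (Cut n q) → Prop
  | feasible : u ∈ P.Sk s.cuts → MBLP.CutsAtCritical P G s u (P.updateUB s u) {typeI u}
  | constructible : u ∉ P.Sk s.cuts → DCConstructible u →
      MBLP.CutsAtCritical P G s u s {typeII u}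
  | classical (V : Finset (Cut n q)) : u ∉ P.Sk s.cuts → ¬ DCConstructible u → G s.cuts u V →
      MBLP.CutsAtCritical P G s u s V

open Classical in
/-- One complete iteration of the while loop which does not return. -/
def MBLP.Step {n q m : ℕ} (P : MBLP n q m) (G : CutRule n q) (t ε : ℝ) (s s' : State n q) : Prop :=
  (ε : EReal) ≤ s.UB - s.LB ∧
  ∃ u₀ : Pt n q, P.SolvesRelaxation s.cuts u₀ ∧ u₀ ∉ P.Sk s.cuts ∧
  ∃ u : Pt n q, P.DCAOutput t (P.Kk s.cuts) u₀ u ∧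
  ∃ V₀ : Finset (Cut n q), G s.cuts u₀ V₀ ∧
  ∃ (s₁ : State n q) (V₁ : Finset (Cut n q)), P.CutsAtCritical G (P.updateLB s u₀) u s₁ V₁ ∧
    s' = { s₁ with cuts := s.cuts ∪ V₀ ∪ V₁ }

/-- The three places at which the algorithm stops: the linear relaxation is infeasible, its
solution is in `𝒮ᵏ`, the while condition `UB - LB ≥ ε` fails. -/
inductive Exit
  | relaxationInfeasible
  | relaxationSolved
  | gapClosed

/-- In the state `s` at the beginning of an iteration, the algorithm stops at the given exit with
the given final values of the variables. -/
inductive MBLP.Stops {n q m : ℕ} (P : MBLP n q m) (ε : ℝ) (s : State n q) :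
    Exit → State n q → Prop
  | relaxationInfeasible : (ε : EReal) ≤ s.UB - s.LB → P.Kk s.cuts = ∅ →
      MBLP.Stops P ε s .relaxationInfeasible s
  | relaxationSolved (u₀ : Pt n q) : (ε : EReal) ≤ s.UB - s.LB → P.SolvesRelaxation s.cuts u₀ →
      u₀ ∈ P.Sk s.cuts →
      MBLP.Stops P ε s .relaxationSolved (P.updateUB (P.updateLB s u₀) u₀)
  | gapClosed : s.UB - s.LB < (ε : EReal) → MBLP.Stops P ε s .gapClosed s

/-- `run 0, …, run N` are the states at the beginnings of the first iterations of a run of the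
algorithm (`run k` belongs to the sets `𝒦ᵏ` and `𝒮ᵏ`). -/
def MBLP.IsRun {n q m : ℕ} (P : MBLP n q m) (G : CutRule n q) (t ε : ℝ) (N : ℕ)
    (run : ℕ → State n q) : Prop :=
  run 0 = start n q ∧ ∀ k < N, P.Step G t ε (run k) (run (k + 1))

/-- The three possible results: the program is found to be infeasible; an exact global optimal
solution is returned; an `ε`-optimal solution is returned, with `UB - LB < ε`. -/
def MBLP.Outcome {n q m : ℕ} (P : MBLP n q m) (ε : ℝ) (e : Exit) (r : State n q) : Prop :=
  (e = .relaxationInfeasible ∧ r.uopt = none ∧ P.S = ∅) ∨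
  ((e = .relaxationInfeasible ∨ e = .relaxationSolved) ∧
    ∃ u, r.uopt = some u ∧ r.fopt = some (P.f u) ∧ P.IsOptimal u) ∨
  (e = .gapClosed ∧
    ∃ u, r.uopt = some u ∧ r.fopt = some (P.f u) ∧ u ∈ P.S ∧ r.UB = (P.f u : EReal) ∧
      r.UB - r.LB < (ε : EReal) ∧ ∀ v ∈ P.S, P.f u < P.f v + ε)

end DCCUT

/-!
Correctness rests on two facts about a critical point `u` of `min {f + t p}` over the current polytope
`K`. If no `x i` is `1/2`, then `p` agrees with the affine function `l_u` near `u`, so `u` minimizes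
the affine function `f + t l_u` over `K` (`MBLP.IsCritical.isMin_linearized`). When `u` is binary,
this says that `u` is the best point with its `x`-part, which is all that the type-I cut removes
(`MBLP.typeI_sat_or_le`). When `u` is not binary, a vertex of `K` with smaller `l_u` would contradict
that `t` is large, so `l_u ≥ l_u (u)` on `K`, and the right-hand side can be rounded up on binary
points (`MBLP.typeII_sat`). Hence the loop preserves `MBLP.Invariant`: every feasible solution that
has been cut off is no better than the incumbent, and `LB` bounds the remaining ones from below.

DCA is finite because it moves between vertices of a polytope, and `h` increases strictly until a
critical point is met (`MBLP.exists_isCritical_of_DCA`).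

Finiteness with lift-and-project cuts has two ingredients. Farkas' lemma shows that a point with
fractional `x j` which satisfies all lift-and-project inequalities for `x j` is a proper convex
combination of two points of the underlying system with `x j = 0` and `x j = 1`
(`exists_disjunctive_points`). If `j` is the last fractional index of a vertex of `K`, these two points
are binary from index `j` on, and therefore satisfy all cuts of higher level too, so that the vertex
would not be extreme: every iteration introduces a cut violated by its vertex
(`MBLP.IsGenerated.not_sat_lpCut`). On the other hand, a cut of level `j + 1` is a basic cut of a
system made of cuts of level at most `j`, so by induction on the level only finitely many cuts can ever
occur (`MBLP.finite_generated_cuts`). Consequently runs are finite, and there are only finitely many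
polytopes and vertices for which the penalty parameter has to be large enough
(`MBLP.exists_uniform_largePenalty`).
-/

open scoped Matrix

namespace DCCUT

/-! ### Linear inequalities: Farkas' lemma, vertices of polyhedra -/

/-- Farkas' lemma for finitely many linear functionals on an arbitrary real vector space, by
induction on the number of functionals: if the last functional `φ k` is really needed, there is a
point `x` with `g x < 0` that violates `φ k` only; all functionals are then composed with the
projection along `x` onto the kernel of `φ k`. -/
theorem farkas {V : Type*} [AddCommGroup V] [Module ℝ V] {ι : Type*} (s : Finset ι) :
    ∀ (φ : ι → V →ₗ[ℝ] ℝ) (g : V →ₗ[ℝ] ℝ), (∀ x, (∀ r ∈ s, 0 ≤ φ r x) → 0 ≤ g x) →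
      ∃ l : ι → ℝ, (∀ r, 0 ≤ l r) ∧ g = ∑ r ∈ s, l r • φ r := by
  classical
  induction s using Finset.induction_on with
  | empty =>
    intro φ g h
    refine ⟨fun _ => 0, fun _ => le_rfl, ?_⟩
    ext x
    have h1 := h x (by simp)
    have h2 := h (-x) (by simp)
    simp only [map_neg] at h2
    simp only [Finset.sum_empty, LinearMap.zero_apply]
    linarith
  | insert k s hk ih =>
    intro φ g h
    by_cases hg : ∀ x, (∀ r ∈ s, 0 ≤ φ r x) → 0 ≤ g x
    · obtain ⟨l, hl, e⟩ := ih φ g hg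
      refine ⟨fun r => if r = k then 0 else l r, fun r => ?_, ?_⟩
      · dsimp only
        split_ifs <;> simp [hl]
      · rw [Finset.sum_insert hk, e]
        simp only [if_true, zero_smul, zero_add]
        exact Finset.sum_congr rfl fun r hr => by rw [if_neg (ne_of_mem_of_not_mem hr hk)]
    · push Not at hg
      obtain ⟨x, hx, hgx⟩ := hg
      have hkx : φ k x < 0 := by
        by_contra hc
        push Not at hc
        have := h x fun r hr => by
          rcases Finset.mem_insert.1 hr with rfl | hr
          · exact hc
          · exact hx r hr
        linarith
      have hne : φ k x ≠ 0 := hkx.ne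
      obtain ⟨l, hl, e⟩ := ih (fun r => φ r - (φ r x / φ k x) • φ k) (g - (g x / φ k x) • φ k) (by
        intro z hz
        have := h (z - (φ k z / φ k x) • x) fun r hr => by
          rcases Finset.mem_insert.1 hr with rfl | hr
          · simp [hne]
          · have := hz r hr
            simp only [LinearMap.sub_apply, LinearMap.smul_apply, smul_eq_mul, map_sub,
              map_smul] at this ⊢
            convert this using 1
            ring
        simp only [LinearMap.sub_apply, LinearMap.smul_apply, smul_eq_mul, map_sub,
              map_smul] at this ⊢
        convert this using 1
        ring)
      refine ⟨fun r => if r = k then (g x - ∑ r ∈ s, l r * φ r x) / φ k x else l r, ?_, ?_⟩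
      · intro r
        dsimp only
        split_ifs
        · refine div_nonneg_of_nonpos ?_ hkx.le
          have : 0 ≤ ∑ r ∈ s, l r * φ r x :=
            Finset.sum_nonneg fun r hr => mul_nonneg (hl r) (hx r hr)
          linarith
        · exact hl r
      · ext z
        have ez := congrArg (fun ψ : V →ₗ[ℝ] ℝ => ψ z) e
        simp only [LinearMap.sub_apply, LinearMap.smul_apply, smul_eq_mul, LinearMap.sum_apply,
          mul_sub, Finset.sum_sub_distrib] at ez
        have e2 : ∑ r ∈ s, l r * (φ r x / φ k x * φ k z)
            = (∑ r ∈ s, l r * φ r x) / φ k x * φ k z := by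
          rw [Finset.sum_div, Finset.sum_mul]
          exact Finset.sum_congr rfl fun r _ => by ring
        rw [Finset.sum_insert hk]
        simp only [if_true, LinearMap.add_apply, LinearMap.smul_apply, smul_eq_mul,
          LinearMap.sum_apply]
        have e3 : ∑ r ∈ s, (if r = k then (g x - ∑ r ∈ s, l r * φ r x) / φ k x else l r) * φ r z
            = ∑ r ∈ s, l r * φ r z :=
          Finset.sum_congr rfl fun r hr => by rw [if_neg (ne_of_mem_of_not_mem hr hk)]
        rw [e3, sub_div, sub_mul]
        linarith

/-- The affine form of Farkas' lemma, as a criterion for solvability: it is `farkas` for the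
homogenized functionals on `V × ℝ`. -/
theorem exists_forall_affine_nonneg {V : Type*} [AddCommGroup V] [Module ℝ V] {ι : Type*}
    [Fintype ι] (φ : ι → V →ₗ[ℝ] ℝ) (s : ι → ℝ)
    (h : ∀ l : ι → ℝ, (∀ r, 0 ≤ l r) → ∑ r, l r • φ r = 0 → 0 ≤ ∑ r, l r * s r) :
    ∃ y, ∀ r, 0 ≤ φ r y + s r := by
  by_contra hc
  push Not at hc
  obtain ⟨l, hl, e⟩ := farkas Finset.univ
    (fun r => (φ r).comp (LinearMap.fst ℝ V ℝ) + s r • LinearMap.snd ℝ V ℝ)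
    (-LinearMap.snd ℝ V ℝ) (by
      rintro ⟨y, τ⟩ hy
      by_contra hτ
      simp only [LinearMap.neg_apply, LinearMap.snd_apply, not_le, neg_lt_zero] at hτ
      obtain ⟨r, hr⟩ := hc (τ⁻¹ • y)
      have := hy r (Finset.mem_univ r)
      simp only [LinearMap.add_apply, LinearMap.comp_apply, LinearMap.fst_apply,
        LinearMap.smul_apply, LinearMap.snd_apply, smul_eq_mul] at this
      rw [map_smul, smul_eq_mul] at hr
      have h3 : τ⁻¹ * (φ r y) + s r = τ⁻¹ * (φ r y + s r * τ) := by field_simp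
      rw [h3] at hr
      have := mul_nonneg (inv_nonneg.2 hτ.le) this
      linarith)
  have h1 : ∑ r, l r • φ r = 0 := by
    ext y
    have := congrArg (fun ψ : V × ℝ →ₗ[ℝ] ℝ => ψ (y, 0)) e
    simpa [eq_comm] using this
  have h2 : -1 = ∑ r, l r * s r := by
    have := congrArg (fun ψ : V × ℝ →ₗ[ℝ] ℝ => ψ (0, 1)) e
    simpa using this
  have := h l hl h1
  linarith

/-- A polyhedron has finitely many extreme points: an extreme point is determined by the set of
inequalities which are active at it. -/
theorem finite_extremePoints_of_polyhedron {V : Type*} [AddCommGroup V] [Module ℝ V] {ι : Type*}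
    (s : Finset ι) (φ : ι → V →ₗ[ℝ] ℝ) (β : ι → ℝ) :
    ({x | ∀ r ∈ s, β r ≤ φ r x} : Set V).extremePoints ℝ |>.Finite := by
  classical
  refine Set.Finite.of_injOn (f := fun x => s.filter fun r => φ r x = β r)
    (t := (s.powerset : Set (Finset ι))) ?_ ?_ (Finset.finite_toSet _)
  · intro x _
    exact Finset.mem_coe.2 (Finset.mem_powerset.2 (Finset.filter_subset _ _))
  · intro x hx y hy hxy
    by_contra hne
    have act : ∀ r ∈ s, φ r x = β r → φ r y = β r := by
      intro r hr h
      have : r ∈ s.filter fun r => φ r x = β r := by simp [hr, h]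
      rw [show (s.filter fun r => φ r x = β r) = s.filter fun r => φ r y = β r from hxy] at this
      exact (Finset.mem_filter.1 this).2
    -- `x - δ (y - x)` stays in the polyhedron for small `δ`
    obtain ⟨δ, hδ, hδs⟩ : ∃ δ : ℝ, 0 < δ ∧ ∀ r ∈ s, β r ≤ φ r x - δ * (φ r y - φ r x) := by
      have : ∀ᶠ δ in nhdsWithin (0 : ℝ) (Set.Ioi 0),
          ∀ r ∈ s, β r ≤ φ r x - δ * (φ r y - φ r x) := by
        rw [Filter.eventually_all_finset]
        intro r hr
        rcases (hx.1 r hr).eq_or_lt with h | h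
        · refine Filter.Eventually.of_forall fun δ => ?_
          rw [act r hr h.symm, ← h]; simp
        · have : Filter.Tendsto (fun δ : ℝ => φ r x - δ * (φ r y - φ r x)) (nhds 0)
              (nhds (φ r x - 0 * (φ r y - φ r x))) := by
            exact Continuous.tendsto (by fun_prop) 0
          simp only [zero_mul, sub_zero] at this
          exact ((this.eventually (lt_mem_nhds h)).filter_mono nhdsWithin_le_nhds).mono
            fun δ hδ => hδ.le
      obtain ⟨δ, h1, h2⟩ := (this.and self_mem_nhdsWithin).exists
      exact ⟨δ, h2, h1⟩
    have hz : x - δ • (y - x) ∈ {x | ∀ r ∈ s, β r ≤ φ r x} := by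
      intro r hr
      simpa using hδs r hr
    -- `x` is a proper convex combination of `y` and `x - δ (y - x)`
    have := hx.2 hy.1 hz ⟨δ / (1 + δ), 1 / (1 + δ), by positivity, by positivity,
      by field_simp; ring, by
      have : (1 + δ) ≠ 0 := by positivity
      have h1 : δ / (1 + δ) = 1 - 1 / (1 + δ) := by field_simp; ring
      have h2 : (1 / (1 + δ)) * δ = 1 - 1 / (1 + δ) := by field_simp; ring
      rw [smul_sub (1 / (1 + δ)), smul_smul, h2, h1]
      module⟩
    exact hne this.symm

/-- A polyhedron given by inequalities and equations has finitely many extreme points. -/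
theorem finite_extremePoints_of_polyhedron_of_eq {V : Type*} [AddCommGroup V] [Module ℝ V]
    {ι κ : Type*} [Fintype ι] [Fintype κ] (φ : ι → V →ₗ[ℝ] ℝ) (β : ι → ℝ) (ψ : κ → V →ₗ[ℝ] ℝ)
    (γ : κ → ℝ) :
    ({x | (∀ r, β r ≤ φ r x) ∧ ∀ k, ψ k x = γ k} : Set V).extremePoints ℝ |>.Finite := by
  convert finite_extremePoints_of_polyhedron (Finset.univ : Finset (ι ⊕ κ ⊕ κ))
    (Sum.elim φ (Sum.elim ψ fun k => -ψ k)) (Sum.elim β (Sum.elim γ fun k => -γ k)) using 2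
  ext x
  simp [forall_and, le_antisymm_iff, and_comm]

/-- A linear function attains its minimum over a nonempty compact set at an extreme point. -/
theorem exists_extremePoint_isMin {V : Type*} [AddCommGroup V] [Module ℝ V] [TopologicalSpace V]
    [T2Space V] [IsTopologicalAddGroup V] [ContinuousSMul ℝ V] [LocallyConvexSpace ℝ V]
    {K : Set V} (hK : IsCompact K) (hne : K.Nonempty) (φ : V →L[ℝ] ℝ) :
    ∃ x ∈ K.extremePoints ℝ, ∀ z ∈ K, φ x ≤ φ z := by
  have hexp : IsExposed ℝ K ((-φ).toExposed K) := ContinuousLinearMap.toExposed.isExposed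
  obtain ⟨x₀, hx₀, hmin⟩ := hK.exists_isMinOn hne φ.continuous.continuousOn
  obtain ⟨x, hx⟩ := (hexp.isCompact hK).extremePoints_nonempty
    ⟨x₀, hx₀, fun z hz => by simpa using hmin hz⟩
  refine ⟨x, hexp.isExtreme.extremePoints_subset_extremePoints hx, fun z hz => ?_⟩
  simpa using hx.1.2 z hz

variable {n q m : ℕ}

/-! ### Compactness and vertices of the reduced polytopes -/

/-- The linear functional `u ↦ a u`. -/
noncomputable def dotL (a : Pt n q) : Pt n q →L[ℝ] ℝ := ∑ i, a i • ContinuousLinearMap.proj i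

@[simp] theorem dotL_apply (a u : Pt n q) : dotL a u = a ⬝ᵥ u := by
  simp [dotL, dotProduct]

theorem MBLP.f_eq_dot (P : MBLP n q m) (u : Pt n q) : P.f u = Sum.elim P.c P.d ⬝ᵥ u := by
  simp [MBLP.f, dotProduct, Fintype.sum_sum_type]

theorem ell_eq_dot (w u : Pt n q) : ell w u = (dcIneq w 0).a ⬝ᵥ u - (dcIneq w 0).β := by
  simp only [ell, dcIneq, dotProduct, Fintype.sum_sum_type, Sum.elim_inl, Sum.elim_inr, zero_mul,
    Finset.sum_const_zero, add_zero, zero_sub, sub_neg_eq_add, ← Finset.sum_add_distrib]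
  refine Finset.sum_congr rfl fun i _ => ?_
  split_ifs <;> ring

open Classical in
theorem MBLP.Kk_eq (P : MBLP n q m) (C : Finset (Cut n q)) :
    P.Kk C = {u | ∀ r ∈ P.baseRows ∪ C.image Cut.ineq, r.β ≤ (dotL r.a : Pt n q →ₗ[ℝ] ℝ) u} := by
  ext u
  simp only [MBLP.Kk, Set.mem_ofPred_eq, P.mem_K_iff_baseRows, Finset.mem_union, Finset.mem_image,
    Ineq.Sat, ContinuousLinearMap.coe_coe, dotL_apply]
  constructor
  · rintro ⟨h1, h2⟩ r (hr | ⟨c, hc, rfl⟩)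
    · exact h1 r hr
    · exact h2 c hc
  · intro h
    exact ⟨fun r hr => h r (Or.inl hr), fun c hc => h _ (Or.inr ⟨c, hc, rfl⟩)⟩

theorem MBLP.finite_vertices (P : MBLP n q m) (C : Finset (Cut n q)) :
    ((P.Kk C).extremePoints ℝ).Finite := by
  classical
  rw [P.Kk_eq]
  exact finite_extremePoints_of_polyhedron _ (fun r : Ineq n q => (dotL r.a : Pt n q →ₗ[ℝ] ℝ)) _

theorem MBLP.isCompact_Kk (P : MBLP n q m) (C : Finset (Cut n q)) : IsCompact (P.Kk C) := by
  classical
  refine (isCompact_univ_pi (s := Sum.elim (fun _ : Fin n => Set.Icc (0 : ℝ) 1)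
    fun j => Set.Icc 0 (P.ybar j)) ?_).of_isClosed_subset ?_ ?_
  · rintro (i | j) <;> exact isCompact_Icc
  · rw [P.Kk_eq]
    simp only [Set.ofPred_forall]
    exact isClosed_biInter fun r _ => isClosed_le continuous_const (dotL r.a).continuous
  · rintro u ⟨hu, -⟩ (i | j) _
    · exact hu.1 i
    · exact hu.2.1 j

/-- A linear program over a nonempty reduced polytope has a vertex solution. -/
theorem MBLP.exists_vertex_isMin (P : MBLP n q m) {C : Finset (Cut n q)} (hne : (P.Kk C).Nonempty)
    (a : Pt n q) : ∃ x ∈ (P.Kk C).extremePoints ℝ, ∀ z ∈ P.Kk C, a ⬝ᵥ x ≤ a ⬝ᵥ z := by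
  simpa using exists_extremePoint_isMin (P.isCompact_Kk C) hne (dotL a)

theorem MBLP.exists_solvesRelaxation (P : MBLP n q m) {C : Finset (Cut n q)}
    (hne : (P.Kk C).Nonempty) : ∃ u₀, P.SolvesRelaxation C u₀ := by
  obtain ⟨x, hx, h⟩ := P.exists_vertex_isMin hne (Sum.elim P.c P.d)
  exact ⟨x, hx, fun u hu => by simpa only [P.f_eq_dot] using h u hu⟩

theorem MBLP.mem_Sk_iff (P : MBLP n q m) (C : Finset (Cut n q)) (u : Pt n q) :
    u ∈ P.Sk C ↔ u ∈ P.Kk C ∧ Binary u := by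
  simp only [MBLP.Sk, MBLP.Kk, MBLP.S, Set.mem_ofPred_eq]
  tauto

/-! ### The penalty function, DCA, critical points -/

theorem penalty_le_ell (w u : Pt n q) : penalty u ≤ ell w u := by
  refine Finset.sum_le_sum fun i _ => ?_
  split_ifs
  · exact min_le_left _ _
  · exact min_le_right _ _

theorem penalty_eq_ell_self (u : Pt n q) : penalty u = ell u u := by
  refine Finset.sum_congr rfl fun i _ => ?_
  split_ifs with h
  · exact min_eq_left (by linarith)
  · exact min_eq_right (by linarith)

/-- Away from the kinks of the penalty function, `ell u` agrees with it near `u`. -/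
theorem eventually_penalty_eq_ell (u d : Pt n q) (hu : ∀ i, u (Sum.inl i) ≠ 1 / 2) :
    ∀ᶠ r in nhds (0 : ℝ), penalty (u + r • d) = ell u (u + r • d) := by
  have key : ∀ i : Fin n, ∀ᶠ r in nhds (0 : ℝ),
      min ((u + r • d) (Sum.inl i)) (1 - (u + r • d) (Sum.inl i)) =
        if u (Sum.inl i) ≤ 1 / 2 then (u + r • d) (Sum.inl i)
          else 1 - (u + r • d) (Sum.inl i) := by
    intro i
    have ht : Filter.Tendsto (fun r : ℝ => (u + r • d) (Sum.inl i)) (nhds 0)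
        (nhds (u (Sum.inl i))) := by
      have : Continuous fun r : ℝ => (u + r • d) (Sum.inl i) := by
        simp only [Pi.add_apply, Pi.smul_apply, smul_eq_mul]; fun_prop
      simpa using this.tendsto 0
    rcases lt_or_gt_of_ne (hu i) with h | h
    · filter_upwards [ht.eventually (gt_mem_nhds h)] with r hr
      rw [if_pos h.le]
      exact min_eq_left (by linarith)
    · filter_upwards [ht.eventually (lt_mem_nhds h)] with r hr
      rw [if_neg (not_le.2 h)]
      exact min_eq_right (by linarith)
  filter_upwards [Filter.eventually_all.2 key] with r hr
  exact Finset.sum_congr rfl fun i _ => hr i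

/-- A critical point without coordinates `1/2` minimizes `f + t l_u` over `K`: a step from `u`
backwards along `z - u` shows that `h` does not decrease there, and `h` is affine near `u`. -/
theorem MBLP.IsCritical.isMin_linearized {P : MBLP n q m} {t : ℝ} {K : Set (Pt n q)} {u : Pt n q}
    (hu : P.IsCritical t K u) (hhalf : ∀ i, u (Sum.inl i) ≠ 1 / 2) {z : Pt n q} (hz : z ∈ K) :
    P.f u + t * ell u u ≤ P.f z + t * ell u z := by
  obtain ⟨v, ⟨-, hv⟩, hsub⟩ := hu
  obtain ⟨r, hr, hr0⟩ := (((eventually_penalty_eq_ell u (z - u) hhalf).filter_mono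
    nhdsWithin_le_nhds).and (self_mem_nhdsWithin (s := Set.Iio (0 : ℝ)))).exists
  have hr0 : r < 0 := hr0
  have h1 := hsub (u + r • (z - u))
  simp only [MBLP.h, hr, penalty_eq_ell_self u, add_sub_cancel_left, dotProduct_smul, smul_eq_mul,
    MBLP.f_eq_dot, ell_eq_dot, dotProduct_add, dotProduct_sub] at h1
  have h2 := hv z hz
  rw [dotProduct_sub] at h2
  have h3 : 0 ≤ r * (v ⬝ᵥ z - v ⬝ᵥ u) := mul_nonneg_of_nonpos_of_nonpos hr0.le h2
  simp only [MBLP.f_eq_dot, ell_eq_dot]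
  have h4 : 0 ≤ -r * ((Sum.elim P.c P.d ⬝ᵥ z + t * ((dcIneq u 0).a ⬝ᵥ z))
      - (Sum.elim P.c P.d ⬝ᵥ u + t * ((dcIneq u 0).a ⬝ᵥ u))) := by linarith
  have := nonneg_of_mul_nonneg_right h4 (by linarith)
  linarith

/-- The slope of the affine function `-f - t l_z` is a subgradient of `h` at `z`. -/
theorem MBLP.subdiff_h_nonempty (P : MBLP n q m) {t : ℝ} (ht : 0 ≤ t) (z : Pt n q) :
    (subdiff (P.h t) z).Nonempty := by
  refine ⟨-(Sum.elim P.c P.d) - t • (dcIneq z 0).a, fun x => ?_⟩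
  have h1 := mul_le_mul_of_nonneg_left (penalty_le_ell z x) ht
  simp only [MBLP.h, penalty_eq_ell_self z]
  simp only [MBLP.f_eq_dot, ell_eq_dot, dotProduct_sub, sub_dotProduct, neg_dotProduct,
    smul_dotProduct, smul_eq_mul] at h1 ⊢
  linarith

theorem MBLP.exists_DCAStep (P : MBLP n q m) {t : ℝ} (ht : 0 ≤ t) {C : Finset (Cut n q)}
    (hne : (P.Kk C).Nonempty) (z : Pt n q) : ∃ z', P.DCAStep t (P.Kk C) z z' := by
  obtain ⟨v, hv⟩ := P.subdiff_h_nonempty ht z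
  obtain ⟨x, hx, h⟩ := P.exists_vertex_isMin hne (-v)
  exact ⟨x, v, hv, hx, by simpa using h⟩

/-- A DCA step which does not increase `h` starts from a critical point. -/
theorem MBLP.DCAStep.isCritical_of_h_le {P : MBLP n q m} {t : ℝ} {K : Set (Pt n q)} {z z' : Pt n q}
    (hz : z ∈ K) (h : P.DCAStep t K z z') (hle : P.h t z' ≤ P.h t z) : P.IsCritical t K z := by
  obtain ⟨v, hv, hz', hmax⟩ := h
  refine ⟨v, ⟨hz, fun x hx => ?_⟩, hv⟩
  have h1 := hv z'
  have h2 := hmax x hx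
  rw [dotProduct_sub] at h1 ⊢
  linarith

/-- DCA over a polytope is finite: `h` increases strictly along vertices as long as the current
point is not critical. -/
theorem MBLP.exists_isCritical_of_DCA (P : MBLP n q m) {t : ℝ} {C : Finset (Cut n q)}
    (z : ℕ → Pt n q) (hz : z 0 ∈ (P.Kk C).extremePoints ℝ)
    (hstep : ∀ i, P.DCAStep t (P.Kk C) (z i) (z (i + 1))) :
    ∃ i, P.IsCritical t (P.Kk C) (z i) := by
  by_contra hc
  push Not at hc
  have hmem : ∀ i, z i ∈ (P.Kk C).extremePoints ℝ := by
    intro i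
    cases i with
    | zero => exact hz
    | succ i => obtain ⟨v, -, h, -⟩ := hstep i; exact h
  have hmono : StrictMono fun i => P.h t (z i) := by
    refine strictMono_nat_of_lt_succ fun i => ?_
    by_contra hle
    exact hc i ((hstep i).isCritical_of_h_le (hmem i).1 (not_lt.1 hle))
  have hinj : Function.Injective z := fun i j h => hmono.injective (congrArg (P.h t) h)
  exact Set.infinite_of_injective_forall_mem hinj hmem (P.finite_vertices C)

theorem MBLP.exists_DCAOutput (P : MBLP n q m) {t : ℝ} (ht : 0 ≤ t) {C : Finset (Cut n q)}
    {u₀ : Pt n q} (hu : u₀ ∈ (P.Kk C).extremePoints ℝ) : ∃ u, P.DCAOutput t (P.Kk C) u₀ u := by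
  choose F hF using P.exists_DCAStep ht (C := C) ⟨u₀, hu.1⟩
  have hstep : ∀ i, P.DCAStep t (P.Kk C) (F^[i] u₀) (F^[i + 1] u₀) := fun i => by
    rw [Function.iterate_succ_apply']; exact hF _
  obtain ⟨i, hi⟩ := P.exists_isCritical_of_DCA (fun i => F^[i] u₀) hu hstep
  refine ⟨F^[i] u₀, ?_, hi⟩
  clear hi
  induction i with
  | zero => exact .refl
  | succ i ih => exact ih.tail (hstep i)

theorem MBLP.DCAOutput.mem_extremePoints {P : MBLP n q m} {t : ℝ} {K : Set (Pt n q)}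
    {u₀ u : Pt n q} (h : P.DCAOutput t K u₀ u) (hu : u₀ ∈ K.extremePoints ℝ) :
    u ∈ K.extremePoints ℝ := by
  rcases h.1.cases_tail with rfl | ⟨z, -, v, -, h, -⟩
  · exact hu
  · exact h

/-! ### Validity and strength of lift-and-project cuts -/

/-- The part of `a u` which does not involve `x j`. -/
noncomputable def restL (j : Fin n) (a : Pt n q) : Pt n q →ₗ[ℝ] ℝ :=
  (dotL (Function.update a (Sum.inl j) 0) : Pt n q →L[ℝ] ℝ)

theorem restL_apply (j : Fin n) (a u : Pt n q) :
    restL j a u = ∑ i, if i = Sum.inl j then 0 else a i * u i := by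
  simp only [restL, ContinuousLinearMap.coe_coe, dotL_apply, dotProduct, Function.update_apply]
  exact Finset.sum_congr rfl fun i _ => by split_ifs <;> simp

theorem dot_eq_restL (j : Fin n) (a u : Pt n q) :
    a ⬝ᵥ u = restL j a u + a (Sum.inl j) * u (Sum.inl j) := by
  rw [restL_apply, dotProduct, ← Finset.sum_add_sum_compl {Sum.inl j}, Finset.sum_singleton,
    add_comm]
  congr 1
  rw [← Finset.sum_add_sum_compl ({Sum.inl j} : Finset (Fin n ⊕ Fin q)) (fun i => ite _ _ _),
    Finset.sum_singleton, if_pos rfl, zero_add]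
  refine Finset.sum_congr rfl fun i hi => ?_
  rw [if_neg (by simpa using hi)]

theorem restL_update (j : Fin n) (a u : Pt n q) (s : ℝ) :
    restL j a (Function.update u (Sum.inl j) s) = restL j a u := by
  simp only [restL_apply]
  refine Finset.sum_congr rfl fun i _ => ?_
  split_ifs with h
  · rfl
  · rw [Function.update_of_ne h]

/-- The slack of a lift-and-project cut, as a function of the multipliers. -/
theorem lpIneq_slack (R : Finset (Ineq n q)) (j : Fin n) (wv : (R → ℝ) × (R → ℝ)) (u : Pt n q) :
    (lpIneq R j wv).a ⬝ᵥ u - (lpIneq R j wv).β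
      = ∑ r, wv.1 r * ((r.1.a (Sum.inl j) - r.1.β) * u (Sum.inl j))
        + ∑ r, wv.2 r * (restL j r.1.a u + r.1.β * u (Sum.inl j) - r.1.β) := by
  have h : restL j (lpIneq R j wv).a u = ∑ r, wv.2 r * restL j r.1.a u := by
    simp only [restL_apply, lpIneq, Finset.mul_sum]
    rw [Finset.sum_comm]
    refine Finset.sum_congr rfl fun i _ => ?_
    split_ifs
    · simp
    · rw [Finset.sum_mul]
      exact Finset.sum_congr rfl fun r _ => by ring
  rw [dot_eq_restL j, h]
  simp only [lpIneq, if_true, Finset.sum_add_distrib, Finset.sum_sub_distrib, mul_sub, mul_add,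
    sub_mul, add_mul, Finset.sum_mul]
  simp only [mul_assoc]
  ring

theorem lpMultipliers_restL {R : Finset (Ineq n q)} {j : Fin n} {w v : R → ℝ} :
    (∀ i : Fin n ⊕ Fin q, i ≠ Sum.inl j → ∑ r, w r * r.1.a i = ∑ r, v r * r.1.a i) ↔
      ∀ u, ∑ r, w r * restL j r.1.a u = ∑ r, v r * restL j r.1.a u := by
  constructor
  · intro h u
    simp only [restL_apply, Finset.mul_sum]
    rw [Finset.sum_comm, Finset.sum_comm (s := Finset.univ (α := R))]
    refine Finset.sum_congr rfl fun i _ => ?_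
    by_cases hi : i = Sum.inl j
    · simp [hi]
    · simp only [if_neg hi, ← mul_assoc, ← Finset.sum_mul, h i hi]
  · intro h i hi
    have := h (Pi.single i 1)
    simpa [restL, hi] using this

/-- Validity of lift-and-project cuts: at a point of the system, the slack of the cut is
`∑ w r (a r z - β r)` if `x j = 1` and `∑ v r (a r z - β r)` if `x j = 0`. -/
theorem lpIneq_sat_of_binary {R : Finset (Ineq n q)} {j : Fin n} {wv : (R → ℝ) × (R → ℝ)}
    (hwv : wv ∈ lpMultipliers R j) {z : Pt n q} (hz : ∀ r ∈ R, r.Sat z)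
    (hj : z (Sum.inl j) = 0 ∨ z (Sum.inl j) = 1) : (lpIneq R j wv).Sat z := by
  obtain ⟨hw, hv, he, -⟩ := hwv
  have he := lpMultipliers_restL.1 he z
  rw [Ineq.Sat, ← sub_nonneg, lpIneq_slack]
  have hs : ∀ r : R, r.1.β ≤ restL j r.1.a z + r.1.a (Sum.inl j) * z (Sum.inl j) := fun r => by
    rw [← dot_eq_restL]; exact hz r.1 r.2
  rcases hj with hj | hj
  · simp only [hj, mul_zero, Finset.sum_const_zero, zero_add, add_zero] at hs ⊢
    exact Finset.sum_nonneg fun r _ => mul_nonneg (hv r) (by linarith [hs r])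
  · simp only [hj, mul_one, add_sub_cancel_right] at hs ⊢
    rw [← he, ← Finset.sum_add_distrib]
    refine Finset.sum_nonneg fun r _ => ?_
    rw [← mul_add]
    exact mul_nonneg (hw r) (by linarith [hs r])

/-- Strength of lift-and-project cuts: a point with `0 < x j < 1` which satisfies all of them is a
convex combination of points of the polyhedron of `R` with `x j = 0` and `x j = 1`.  The multipliers
of the cuts are exactly the Farkas multipliers of the system for the (rescaled) second point. -/
theorem exists_disjunctive_points {R : Finset (Ineq n q)} {j : Fin n} {u : Pt n q}
    (h0 : 0 < u (Sum.inl j)) (h1 : u (Sum.inl j) < 1)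
    (h : ∀ wv ∈ lpMultipliers R j, (lpIneq R j wv).Sat u) :
    ∃ a b : Pt n q, (∀ r ∈ R, r.Sat a) ∧ (∀ r ∈ R, r.Sat b) ∧ a (Sum.inl j) = 0 ∧
      b (Sum.inl j) = 1 ∧ u = (1 - u (Sum.inl j)) • a + u (Sum.inl j) • b := by
  set τ := u (Sum.inl j) with hτ
  have h1' : 0 < 1 - τ := by linarith
  obtain ⟨y, hy⟩ := exists_forall_affine_nonneg (ι := R ⊕ R)
    (Sum.elim (fun r => restL j r.1.a) fun r => -restL j r.1.a)
    (Sum.elim (fun r => (r.1.a (Sum.inl j) - r.1.β) * τ)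
      fun r => restL j r.1.a u + r.1.β * τ - r.1.β) (by
    intro l hl he
    rw [Fintype.sum_sum_type] at he ⊢
    simp only [Sum.elim_inl, Sum.elim_inr, smul_neg, Finset.sum_neg_distrib] at he ⊢
    have hs0 : 0 ≤ ∑ r : R, l (Sum.inl r) := Finset.sum_nonneg fun r _ => hl _
    have hs1 : 0 ≤ ∑ r : R, l (Sum.inr r) := Finset.sum_nonneg fun r _ => hl _
    rcases (add_nonneg hs0 hs1).eq_or_lt with hs | hs
    · have e0 : ∑ r : R, l (Sum.inl r) = 0 := by linarith
      have e1 : ∑ r : R, l (Sum.inr r) = 0 := by linarith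
      rw [Finset.sum_eq_zero_iff_of_nonneg fun r _ => hl _] at e0 e1
      rw [Finset.sum_eq_zero fun r hr => by rw [e0 r hr, zero_mul],
        Finset.sum_eq_zero fun r hr => by rw [e1 r hr, zero_mul], zero_add]
    · set σ := ∑ r : R, l (Sum.inl r) + ∑ r : R, l (Sum.inr r) with hσ
      have hmem : ((fun r => l (Sum.inl r) / σ, fun r => l (Sum.inr r) / σ) :
          (R → ℝ) × (R → ℝ)) ∈ lpMultipliers R j := by
        refine ⟨fun r => div_nonneg (hl _) hs.le, fun r => div_nonneg (hl _) hs.le, ?_, ?_⟩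
        · rw [lpMultipliers_restL]
          intro x
          have := congrArg (fun ψ : Pt n q →ₗ[ℝ] ℝ => ψ x) he
          simp only [LinearMap.add_apply, LinearMap.neg_apply, LinearMap.sum_apply,
            LinearMap.smul_apply, smul_eq_mul, LinearMap.zero_apply] at this
          simp only [div_mul_eq_mul_div, ← Finset.sum_div]
          rw [show ∑ r : R, l (Sum.inl r) * restL j r.1.a x
            = ∑ r : R, l (Sum.inr r) * restL j r.1.a x by linarith]
        · simp only [← Finset.sum_div]
          rw [← add_div, ← hσ, div_self hs.ne']
      have := h _ hmem
      rw [Ineq.Sat, ← sub_nonneg, lpIneq_slack] at this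
      simp only [div_mul_eq_mul_div, ← Finset.sum_div] at this
      rw [← add_div] at this
      have := mul_nonneg this hs.le
      rwa [div_mul_cancel₀ _ hs.ne'] at this)
  refine ⟨Function.update ((1 - τ)⁻¹ • (u - y)) (Sum.inl j) 0,
    Function.update (τ⁻¹ • y) (Sum.inl j) 1, fun r hr => ?_, fun r hr => ?_, by simp, by simp, ?_⟩
  · have := hy (Sum.inr ⟨r, hr⟩)
    simp only [Sum.elim_inr, LinearMap.neg_apply] at this
    rw [Ineq.Sat, dot_eq_restL j, restL_update, map_smul, map_sub, smul_eq_mul,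
      Function.update_self, mul_zero, add_zero, inv_mul_eq_div, le_div_iff₀ h1']
    linarith
  · have := hy (Sum.inl ⟨r, hr⟩)
    simp only [Sum.elim_inl] at this
    rw [Ineq.Sat, dot_eq_restL j, restL_update, map_smul, smul_eq_mul, Function.update_self,
      mul_one, inv_mul_eq_div, ← sub_le_iff_le_add, le_div_iff₀ h0]
    linarith
  · ext i
    by_cases hi : i = Sum.inl j
    · subst hi; simp [hτ]
    · simp only [Pi.add_apply, Pi.smul_apply, Function.update_of_ne hi, Pi.sub_apply, smul_eq_mul]
      field_simp
      ring

theorem isCompact_lpMultipliers (R : Finset (Ineq n q)) (j : Fin n) :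
    IsCompact (lpMultipliers R j) := by
  refine (isCompact_Icc (a := ((fun _ => 0, fun _ => 0) : (R → ℝ) × (R → ℝ)))
    (b := (fun _ => 1, fun _ => 1))).of_isClosed_subset ?_ ?_
  · simp only [lpMultipliers, Set.ofPred_and, Set.ofPred_forall]
    refine IsClosed.inter (isClosed_iInter fun r => isClosed_le (by fun_prop) (by fun_prop)) ?_
    refine IsClosed.inter (isClosed_iInter fun r => isClosed_le (by fun_prop) (by fun_prop)) ?_
    exact IsClosed.inter (isClosed_iInter fun i => isClosed_iInter fun _ =>
      isClosed_eq (by fun_prop) (by fun_prop)) (isClosed_eq (by fun_prop) (by fun_prop))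
  · rintro ⟨w, v⟩ ⟨hw, hv, -, hs⟩
    have hs0 : 0 ≤ ∑ r : R, w r := Finset.sum_nonneg fun r _ => hw _
    have hs1 : 0 ≤ ∑ r : R, v r := Finset.sum_nonneg fun r _ => hv _
    dsimp only at hs
    refine ⟨⟨hw, hv⟩, fun r => ?_, fun r => ?_⟩
    · have := Finset.single_le_sum (fun r _ => hw r) (Finset.mem_univ r)
      dsimp only at this ⊢
      linarith
    · have := Finset.single_le_sum (fun r _ => hv r) (Finset.mem_univ r)
      dsimp only at this ⊢
      linarith

theorem lpMultipliers_nonempty {R : Finset (Ineq n q)} (hR : R.Nonempty) (j : Fin n) :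
    (lpMultipliers R j).Nonempty := by
  classical
  obtain ⟨r, hr⟩ := hR
  have hpos : ∀ k : R, 0 ≤ (Pi.single ⟨r, hr⟩ (1 / 2) : R → ℝ) k := fun k => by
    rw [Pi.single_apply]; split_ifs <;> norm_num
  refine ⟨(Pi.single ⟨r, hr⟩ (1 / 2), Pi.single ⟨r, hr⟩ (1 / 2)), ?_, ?_, fun _ _ => rfl, ?_⟩
  · exact hpos
  · exact hpos
  · simp only [Finset.sum_pi_single', Finset.mem_univ, if_true]
    norm_num

theorem finite_extremePoints_lpMultipliers (R : Finset (Ineq n q)) (j : Fin n) :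
    ((lpMultipliers R j).extremePoints ℝ).Finite := by
  classical
  let p1 : R → ((R → ℝ) × (R → ℝ)) →ₗ[ℝ] ℝ := fun r => LinearMap.proj r ∘ₗ LinearMap.fst ℝ _ _
  let p2 : R → ((R → ℝ) × (R → ℝ)) →ₗ[ℝ] ℝ := fun r => LinearMap.proj r ∘ₗ LinearMap.snd ℝ _ _
  have hfin := finite_extremePoints_of_polyhedron_of_eq (Sum.elim p1 p2) (fun _ => 0)
    (κ := Option {i : Fin n ⊕ Fin q // i ≠ Sum.inl j})
    (fun o => o.elim (∑ r, p1 r + ∑ r, p2 r)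
      fun i => ∑ r, r.1.a i.1 • p1 r - ∑ r, r.1.a i.1 • p2 r)
    (fun o => o.elim 1 fun _ => 0)
  refine (Set.ext fun wv => ?_ : lpMultipliers R j = _) ▸ hfin
  simp only [lpMultipliers, ne_eq, Set.mem_ofPred_eq, Sum.forall, Sum.elim_inl, Sum.elim_inr,
    Option.forall, Option.elim_none, Option.elim_some, LinearMap.add_apply, LinearMap.sum_apply,
    LinearMap.sub_apply, LinearMap.smul_apply, smul_eq_mul, Subtype.forall, sub_eq_zero, p1, p2,
    LinearMap.comp_apply, LinearMap.fst_apply, LinearMap.snd_apply, LinearMap.proj_apply,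
    mul_comm (Ineq.a _ _)]
  tauto

/-- The violation at `u`, as a linear function of the multipliers, has a basic maximizer. -/
theorem exists_isLPCut {R : Finset (Ineq n q)} (hR : R.Nonempty) (j : Fin n) (u : Pt n q) :
    ∃ r, IsLPCut R j u r := by
  obtain ⟨wv, hwv, h⟩ := exists_extremePoint_isMin (isCompact_lpMultipliers R j)
    (lpMultipliers_nonempty hR j) (LinearMap.toContinuousLinearMap
      ((∑ r : R, ((r.1.a (Sum.inl j) - r.1.β) * u (Sum.inl j)) •
          (LinearMap.proj r ∘ₗ LinearMap.fst ℝ (R → ℝ) (R → ℝ)))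
        + ∑ r : R, (restL j r.1.a u + r.1.β * u (Sum.inl j) - r.1.β) •
          (LinearMap.proj r ∘ₗ LinearMap.snd ℝ (R → ℝ) (R → ℝ))))
  refine ⟨_, wv, hwv, fun wv' hwv' => ?_, rfl⟩
  rw [← neg_sub, ← neg_sub ((lpIneq R j wv).a ⬝ᵥ u), neg_le_neg_iff, lpIneq_slack, lpIneq_slack]
  simpa [mul_comm] using h wv' hwv'

/-! ### Families of cuts generated by the lift-and-project rule -/

/-- The inequalities `l_w (u) ≥ k` with an integer `0 ≤ k ≤ n + 1`, as cuts of level `0`.  The range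
of `k` contains all right-hand sides of DC cuts introduced at points of `𝒦`. -/
def dcCuts (n q : ℕ) : Set (Cut n q) :=
  {c | ∃ (w : Pt n q) (k : ℤ), 0 ≤ k ∧ k ≤ n + 1 ∧ c = ⟨0, dcIneq w k⟩}

theorem finite_dcCuts (n q : ℕ) : (dcCuts n q).Finite := by
  classical
  -- `dcIneq w k` depends on `w` only through the set of `i` with `w i ≤ 1/2`
  refine ((Set.finite_univ (α := Finset (Fin n))).prod (Set.finite_Icc (0 : ℤ) (n + 1))).image
    (fun p => (⟨0, dcIneq (Sum.elim (fun i => if i ∈ p.1 then 0 else 1) fun _ => 0) p.2⟩ :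
      Cut n q)) |>.subset ?_
  rintro _ ⟨w, k, h0, h1, rfl⟩
  refine ⟨(Finset.univ.filter fun i => w (Sum.inl i) ≤ 1 / 2, k), ⟨Set.mem_univ _, h0, h1⟩, ?_⟩
  have key : ∀ i : Fin n,
      ((if w (Sum.inl i) ≤ 1 / 2 then (0 : ℝ) else 1) ≤ 1 / 2) = (w (Sum.inl i) ≤ 1 / 2) := by
    intro i
    split_ifs with h <;> simp only [h, eq_iff_iff, iff_true, iff_false] <;> norm_num
  simp only [dcIneq, Sum.elim_inl, Finset.mem_filter, Finset.mem_univ, true_and, key]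

/-- `c` is a DC cut, or a basic lift-and-project cut derived, for some `j`, from constraints of `𝒦`
and cuts of level at most `j` of a subfamily of `C`.  The subfamily stands for the cuts which were
present when `c` was derived; optimality of the basic solution is not recorded. -/
def MBLP.GeneratedFrom (P : MBLP n q m) (C : Finset (Cut n q)) (c : Cut n q) : Prop :=
  c ∈ dcCuts n q ∨ ∃ j : Fin n, c.level = (j : ℕ) + 1 ∧ ∃ C' ⊆ C,
    ∃ wv ∈ (lpMultipliers (P.rows C' j) j).extremePoints ℝ, c.ineq = lpIneq (P.rows C' j) j wv

/-- Every cut of the family `C` is generated from cuts of `C`. -/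
def MBLP.IsGenerated (P : MBLP n q m) (C : Finset (Cut n q)) : Prop :=
  ∀ c ∈ C, P.GeneratedFrom C c

theorem MBLP.sat_rows_iff (P : MBLP n q m) (C : Finset (Cut n q)) (j : Fin n) (z : Pt n q) :
    (∀ r ∈ P.rows C j, r.Sat z) ↔ z ∈ P.K ∧ ∀ c ∈ C, c.level ≤ (j : ℕ) → c.ineq.Sat z := by
  classical
  simp only [MBLP.rows, Finset.mem_union, Finset.mem_image, Finset.mem_filter,
    P.mem_K_iff_baseRows]
  constructor
  · intro h
    exact ⟨fun r hr => h r (Or.inl hr), fun c hc hl => h _ (Or.inr ⟨c, ⟨hc, hl⟩, rfl⟩)⟩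
  · rintro ⟨h1, h2⟩ r (hr | ⟨c, ⟨hc, hl⟩, rfl⟩)
    · exact h1 r hr
    · exact h2 c hc hl

theorem MBLP.isGlobalCutRule_liftProject (P : MBLP n q m) : P.IsGlobalCutRule P.liftProject := by
  intro C u V hV c hc z hz
  obtain ⟨j, -, -, wv, hwv, -, e⟩ := hV.1 c hc
  rw [e]
  exact lpIneq_sat_of_binary hwv.1 ((P.sat_rows_iff C j z).2 ⟨hz.1.1, fun c hc _ => hz.2 c hc⟩)
    (hz.1.2 j)

/-- The cuts of level `> j` are satisfied by a point which satisfies those of level `≤ j` and whose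
coordinates `x i`, `j ≤ i`, are binary: by induction on the level, since a cut from `x i` is valid
for the points with binary `x i` of the system it is derived from. -/
theorem MBLP.IsGenerated.sat_of_binary_tail {P : MBLP n q m} {C : Finset (Cut n q)}
    (hC : P.IsGenerated C) {j : Fin n} {z : Pt n q} (hz : ∀ r ∈ P.rows C j, r.Sat z)
    (hbin : ∀ i, j ≤ i → z (Sum.inl i) = 0 ∨ z (Sum.inl i) = 1) : ∀ c ∈ C, c.ineq.Sat z := by
  rw [P.sat_rows_iff] at hz
  suffices h : ∀ k, ∀ c ∈ C, c.level = k → c.ineq.Sat z from fun c hc => h _ c hc rfl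
  intro k
  induction k using Nat.strong_induction_on with
  | _ k ih =>
    rintro c hc rfl
    by_cases hl : c.level ≤ (j : ℕ)
    · exact hz.2 c hc hl
    · rcases hC c hc with ⟨w, k, -, -, rfl⟩ | ⟨i, hi, C', hC', wv, hwv, e⟩
      · exact absurd (Nat.zero_le _) hl
      · rw [e]
        refine lpIneq_sat_of_binary hwv.1 ((P.sat_rows_iff C' i z).2 ⟨hz.1, fun c' hc' hl' => ?_⟩)
          (hbin i (Fin.le_def.2 (by omega)))
        exact ih c'.level (by omega) c' (hC' hc') rfl

theorem eq_of_convex_comb_binary {a b s τ : ℝ} (h0 : 0 < τ) (h1 : τ < 1) (ha : 0 ≤ a ∧ a ≤ 1)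
    (hb : 0 ≤ b ∧ b ≤ 1) (hs : s = 0 ∨ s = 1) (h : s = (1 - τ) * a + τ * b) :
    a = s ∧ b = s := by
  have h1' : 0 < 1 - τ := by linarith
  rcases hs with rfl | rfl
  · have := mul_nonneg h1'.le ha.1
    have := mul_nonneg h0.le hb.1
    have e1 : (1 - τ) * a = 0 := by linarith
    have e2 : τ * b = 0 := by linarith
    exact ⟨(mul_eq_zero.1 e1).resolve_left h1'.ne', (mul_eq_zero.1 e2).resolve_left h0.ne'⟩
  · have := mul_nonneg h1'.le (sub_nonneg.2 ha.2)
    have := mul_nonneg h0.le (sub_nonneg.2 hb.2)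
    have e1 : (1 - τ) * (1 - a) = 0 := by linarith
    have e2 : τ * (1 - b) = 0 := by linarith
    have := (mul_eq_zero.1 e1).resolve_left h1'.ne'
    have := (mul_eq_zero.1 e2).resolve_left h0.ne'
    exact ⟨by linarith, by linarith⟩

/-- The lift-and-project cut from the last fractional variable cuts off a vertex of the current
polytope: otherwise the vertex would be a proper convex combination of two points of the system with
`x j ∈ {0, 1}`; these agree with the vertex in the later `x`-coordinates, hence satisfy all cuts. -/
theorem MBLP.IsGenerated.not_sat_lpCut {P : MBLP n q m} {C : Finset (Cut n q)}
    (hC : P.IsGenerated C) {u : Pt n q} (hu : u ∈ (P.Kk C).extremePoints ℝ) {j : Fin n}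
    (hj : Fractional u j) (hlast : ∀ i, j < i → ¬ Fractional u i) {r : Ineq n q}
    (hr : IsLPCut (P.rows C j) j u r) : ¬ r.Sat u := by
  obtain ⟨wv, -, hmax, rfl⟩ := hr
  intro hsat
  have h0 : 0 < u (Sum.inl j) := (hu.1.1.1 j).1.lt_of_ne hj.1.symm
  have h1 : u (Sum.inl j) < 1 := (hu.1.1.1 j).2.lt_of_ne hj.2
  obtain ⟨a, b, ha, hb, haj, hbj, e⟩ := exists_disjunctive_points h0 h1 fun wv' hwv' => by
    have := hmax wv' hwv'
    simp only [Ineq.Sat] at hsat ⊢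
    linarith
  have haK := ((P.sat_rows_iff C j a).1 ha).1
  have hbK := ((P.sat_rows_iff C j b).1 hb).1
  have tail : ∀ i, j < i → a (Sum.inl i) = u (Sum.inl i) ∧ b (Sum.inl i) = u (Sum.inl i) ∧
      (u (Sum.inl i) = 0 ∨ u (Sum.inl i) = 1) := by
    intro i hi
    have hbin : u (Sum.inl i) = 0 ∨ u (Sum.inl i) = 1 := by
      have := hlast i hi
      simp only [Fractional] at this
      tauto
    have := eq_of_convex_comb_binary h0 h1 (haK.1 i) (hbK.1 i) hbin (congrFun e (Sum.inl i))
    exact ⟨this.1, this.2, hbin⟩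
  have ha' : a ∈ P.Kk C := ⟨haK, hC.sat_of_binary_tail ha fun i hi => by
    rcases hi.eq_or_lt with rfl | hi
    · exact Or.inl haj
    · rw [(tail i hi).1]; exact (tail i hi).2.2⟩
  have hb' : b ∈ P.Kk C := ⟨hbK, hC.sat_of_binary_tail hb fun i hi => by
    rcases hi.eq_or_lt with rfl | hi
    · exact Or.inr hbj
    · rw [(tail i hi).2.1]; exact (tail i hi).2.2⟩
  have := hu.2 ha' hb' ⟨1 - u (Sum.inl j), u (Sum.inl j), by linarith, h0, by ring, e.symm⟩
  rw [← this, haj] at h0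
  exact lt_irrefl _ h0

/-- Only finitely many cuts occur in generated families, by induction on the level: there are
finitely many systems to derive a cut from, each with finitely many basic multipliers. -/
theorem MBLP.finite_generated_cuts (P : MBLP n q m) :
    {c | ∃ C, P.IsGenerated C ∧ c ∈ C}.Finite := by
  classical
  have key : ∀ k : ℕ, {c | c.level ≤ k ∧ ∃ C, P.IsGenerated C ∧ c ∈ C}.Finite := by
    intro k
    induction k with
    | zero =>
      refine (finite_dcCuts n q).subset ?_
      rintro c ⟨hl, C, hC, hc⟩
      rcases hC c hc with h | ⟨j, hj, -⟩
      · exact h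
      · omega
    | succ k ih =>
      have hfin : (⋃ j : Fin n, ⋃ D ∈ (ih.toFinset.powerset : Set (Finset (Cut n q))),
          (fun wv => (⟨k + 1, lpIneq (P.baseRows ∪ D.image Cut.ineq) j wv⟩ : Cut n q)) ''
            (lpMultipliers (P.baseRows ∪ D.image Cut.ineq) j).extremePoints ℝ).Finite :=
        Set.finite_iUnion fun j => Set.Finite.biUnion (Finset.finite_toSet _) fun D _ =>
          (finite_extremePoints_lpMultipliers _ j).image _
      refine (ih.union hfin).subset ?_
      rintro c ⟨hl, C, hC, hc⟩
      rcases hl.lt_or_eq with hl | hl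
      · exact Or.inl ⟨Nat.lt_succ_iff.1 hl, C, hC, hc⟩
      right
      rcases hC c hc with ⟨w, i, -, -, rfl⟩ | ⟨j, hj, C', hC', wv, hwv, e⟩
      · exact absurd hl (Nat.succ_ne_zero k).symm
      · refine Set.mem_iUnion.2 ⟨j, Set.mem_iUnion₂.2
          ⟨C'.filter fun c => c.level ≤ (j : ℕ), ?_, wv, hwv, ?_⟩⟩
        · refine Finset.mem_coe.2 (Finset.mem_powerset.2 fun c' hc' => ?_)
          rw [Finset.mem_filter] at hc'
          exact ih.mem_toFinset.2 ⟨by omega, C, hC, hC' hc'.1⟩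
        · obtain ⟨l, i⟩ := c
          dsimp only at e hl ⊢
          rw [e, hl]
          rfl
  refine (key n).subset fun c hc => ⟨?_, hc⟩
  obtain ⟨C, hC, hc⟩ := hc
  rcases hC c hc with ⟨w, i, -, -, rfl⟩ | ⟨j, hj, -⟩
  · exact Nat.zero_le _
  · have := j.2
    omega

theorem MBLP.liftProject_nonempty (P : MBLP n q m) (C : Finset (Cut n q)) {u : Pt n q}
    (hu : ¬ Binary u) : ∃ V, P.liftProject C u V := by
  classical
  simp only [Binary, not_forall, not_or] at hu
  obtain ⟨i, hi⟩ := hu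
  have hne : (Finset.univ.filter fun j => Fractional u j).Nonempty :=
    ⟨i, Finset.mem_filter.2 ⟨Finset.mem_univ _, hi⟩⟩
  obtain ⟨j, hj, hmax⟩ := Finset.exists_max_image _ id hne
  have hj' : Fractional u j := (Finset.mem_filter.1 hj).2
  have hR : (P.rows C j).Nonempty := ⟨⟨Pi.single (Sum.inl j) 1, 0⟩, by
    simp only [MBLP.rows, MBLP.baseRows, Finset.mem_union, Finset.mem_image, Finset.mem_univ,
      true_and]
    exact Or.inl (Or.inl (Or.inl (Or.inr ⟨_, rfl⟩)))⟩
  obtain ⟨r, hr⟩ := exists_isLPCut hR j u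
  refine ⟨{⟨j + 1, r⟩}, fun c hc => ?_, j, hj', fun i hi hfi => ?_, _,
    Finset.mem_singleton_self _, rfl⟩
  · rw [Finset.mem_singleton.1 hc]
    exact ⟨j, rfl, hj', hr⟩
  · exact absurd (hmax i (Finset.mem_filter.2 ⟨Finset.mem_univ _, hfi⟩)) (not_le.2 hi)

/-! ### One iteration of the algorithm -/

theorem penalty_nonneg_of_mem {P : MBLP n q m} {u : Pt n q} (hu : u ∈ P.K) : 0 ≤ penalty u :=
  Finset.sum_nonneg fun i _ => le_min (hu.1 i).1 (sub_nonneg.2 (hu.1 i).2)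

theorem penalty_le_of_mem {P : MBLP n q m} {u : Pt n q} (hu : u ∈ P.K) : penalty u ≤ n := by
  have : penalty u ≤ ∑ _i : Fin n, (1 : ℝ) :=
    Finset.sum_le_sum fun i _ => (min_le_left _ _).trans (hu.1 i).2
  simpa using this

theorem typeI_mem_dcCuts (u : Pt n q) : typeI u ∈ dcCuts n q :=
  ⟨u, 1, by norm_num, by omega, by simp [typeI]⟩

theorem typeII_mem_dcCuts {P : MBLP n q m} {u : Pt n q} (hu : u ∈ P.K) :
    typeII u ∈ dcCuts n q := by
  have h0 := penalty_nonneg_of_mem hu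
  have h1 := penalty_le_of_mem hu
  rw [penalty_eq_ell_self] at h0 h1
  refine ⟨u, ⌈ell u u⌉, Int.ceil_nonneg h0, ?_, rfl⟩
  have : ⌈ell u u⌉ ≤ (n : ℤ) := Int.ceil_le.2 (by exact_mod_cast h1)
  omega

theorem ell_integer_of_binary (w : Pt n q) {v : Pt n q} (hv : Binary v) :
    ∃ k : ℤ, ell w v = k := by
  refine ⟨∑ i : Fin n, if w (Sum.inl i) ≤ 1 / 2 then (if v (Sum.inl i) = 0 then 0 else 1)
    else (if v (Sum.inl i) = 0 then 1 else 0), ?_⟩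
  rw [Int.cast_sum]
  refine Finset.sum_congr rfl fun i _ => ?_
  rcases hv i with h | h <;> split_ifs <;> simp_all

theorem MBLP.updateUB_cuts (P : MBLP n q m) (s : State n q) (u : Pt n q) :
    (P.updateUB s u).cuts = s.cuts := by
  unfold MBLP.updateUB; split_ifs <;> rfl

theorem MBLP.updateUB_LB (P : MBLP n q m) (s : State n q) (u : Pt n q) :
    (P.updateUB s u).LB = s.LB := by
  unfold MBLP.updateUB; split_ifs <;> rfl

theorem MBLP.updateUB_UB (P : MBLP n q m) (s : State n q) (u : Pt n q) :
    (P.updateUB s u).UB = min s.UB (P.f u) := by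
  unfold MBLP.updateUB
  split_ifs with h
  · exact (min_eq_right h.le).symm
  · exact (min_eq_left (not_lt.1 h)).symm

theorem MBLP.IsGenerated.union {P : MBLP n q m} {C D : Finset (Cut n q)} [DecidableEq (Cut n q)]
    (hC : P.IsGenerated C) (hD : ∀ c ∈ D, P.GeneratedFrom C c) : P.IsGenerated (C ∪ D) := by
  intro c hc
  rcases (Finset.mem_union.1 hc).elim (hC c) (hD c) with h | ⟨j, hj, C', hC', h⟩
  · exact Or.inl h
  · exact Or.inr ⟨j, hj, C', hC'.trans Finset.subset_union_left, h⟩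

theorem MBLP.generatedFrom_of_liftProject {P : MBLP n q m} {C V : Finset (Cut n q)} {u : Pt n q}
    (hV : P.liftProject C u V) : ∀ c ∈ V, P.GeneratedFrom C c := by
  intro c hc
  obtain ⟨j, hj, -, wv, hwv, -, e⟩ := hV.1 c hc
  exact Or.inr ⟨j, hj, C, Finset.Subset.refl _, wv, hwv, e⟩

theorem MBLP.Step.isGenerated {P : MBLP n q m} {t ε : ℝ} {s s' : State n q}
    (h : P.Step P.liftProject t ε s s') (hs : P.IsGenerated s.cuts) : P.IsGenerated s'.cuts := by
  classical
  obtain ⟨-, u₀, hu₀, -, u, hu, V₀, hV₀, s₁, V₁, hV₁, rfl⟩ := h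
  have huK := (hu.mem_extremePoints hu₀.1).1.1
  dsimp only
  rw [Finset.union_assoc]
  refine hs.union fun c hc => ?_
  rcases Finset.mem_union.1 hc with hc | hc
  · exact generatedFrom_of_liftProject hV₀ c hc
  · cases hV₁ with
    | feasible h =>
      rw [Finset.mem_singleton.1 hc]
      exact Or.inl (typeI_mem_dcCuts u)
    | constructible h h' =>
      rw [Finset.mem_singleton.1 hc]
      exact Or.inl (typeII_mem_dcCuts huK)
    | classical _ h h' hG => exact generatedFrom_of_liftProject hG c hc

/-- An iteration introduces a cut which is violated at the vertex `u₀`, hence new. -/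
theorem MBLP.Step.card_lt {P : MBLP n q m} {t ε : ℝ} {s s' : State n q}
    (h : P.Step P.liftProject t ε s s') (hs : P.IsGenerated s.cuts) :
    s.cuts.card < s'.cuts.card := by
  classical
  obtain ⟨-, u₀, hu₀, -, u, hu, V₀, ⟨hV₀, j, hj, hlast, c, hc, hcj⟩, s₁, V₁, -, rfl⟩ := h
  refine Finset.card_lt_card (Finset.ssubset_iff_of_subset ?_ |>.2 ⟨c, ?_, fun hmem => ?_⟩)
  · exact Finset.subset_union_left.trans Finset.subset_union_left
  · simp [hc]
  · obtain ⟨i, hi, -, hr⟩ := hV₀ c hc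
    obtain rfl : i = j := Fin.ext (by omega)
    exact hs.not_sat_lpCut hu₀.1 hj hlast hr (hu₀.1.1.2 c hmem)

theorem MBLP.exists_step (P : MBLP n q m) {t ε : ℝ} (ht : 0 < t) (s : State n q) :
    (∃ e r, P.Stops ε s e r) ∨ ∃ s', P.Step P.liftProject t ε s s' := by
  by_cases hgap : (ε : EReal) ≤ s.UB - s.LB
  swap
  · exact Or.inl ⟨_, _, .gapClosed (not_le.1 hgap)⟩
  rcases (P.Kk s.cuts).eq_empty_or_nonempty with hK | hK
  · exact Or.inl ⟨_, _, .relaxationInfeasible hgap hK⟩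
  obtain ⟨u₀, hu₀⟩ := P.exists_solvesRelaxation hK
  by_cases hS : u₀ ∈ P.Sk s.cuts
  · exact Or.inl ⟨_, _, .relaxationSolved u₀ hgap hu₀ hS⟩
  right
  have classical_cuts : ∀ u ∈ P.Kk s.cuts, u ∉ P.Sk s.cuts → ∃ V, P.liftProject s.cuts u V :=
    fun u hu hS => P.liftProject_nonempty _ fun hb => hS ((P.mem_Sk_iff _ _).2 ⟨hu, hb⟩)
  obtain ⟨V₀, hV₀⟩ := classical_cuts u₀ hu₀.1.1 hS
  obtain ⟨u, hu⟩ := P.exists_DCAOutput ht.le hu₀.1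
  have huK := (hu.mem_extremePoints hu₀.1).1
  obtain ⟨s₁, V₁, h⟩ : ∃ s₁ V₁, P.CutsAtCritical P.liftProject (P.updateLB s u₀) u s₁ V₁ := by
    by_cases huS : u ∈ P.Sk s.cuts
    · exact ⟨_, _, .feasible huS⟩
    by_cases hc : DCConstructible u
    · exact ⟨_, _, .constructible huS hc⟩
    obtain ⟨V, hV⟩ := classical_cuts u huK huS
    exact ⟨_, V, .classical V huS hc hV⟩
  exact ⟨_, hgap, u₀, hu₀, hS, u, hu, V₀, hV₀, s₁, V₁, h, rfl⟩

/-! ### Runs with lift-and-project cuts -/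

theorem MBLP.IsRun.isGenerated {P : MBLP n q m} {t ε : ℝ} {N : ℕ} {run : ℕ → State n q}
    (h : P.IsRun P.liftProject t ε N run) : ∀ k ≤ N, P.IsGenerated (run k).cuts := by
  intro k
  induction k with
  | zero => intro _ c hc; simp [h.1, start] at hc
  | succ k ih => intro hk; exact (h.2 k hk).isGenerated (ih (by omega))

theorem MBLP.not_exists_infinite_run (P : MBLP n q m) (t ε : ℝ) :
    ¬ ∃ run : ℕ → State n q, ∀ N, P.IsRun P.liftProject t ε N run := by
  rintro ⟨run, h⟩
  have hgen : ∀ k, P.IsGenerated (run k).cuts := fun k => (h k).isGenerated k le_rfl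
  have hmono : StrictMono fun k => (run k).cuts.card :=
    strictMono_nat_of_lt_succ fun k => ((h (k + 1)).2 k (Nat.lt_succ_self k)).card_lt (hgen k)
  have hle : ∀ k, (run k).cuts.card ≤ P.finite_generated_cuts.toFinset.card := fun k =>
    Finset.card_le_card fun c hc => P.finite_generated_cuts.mem_toFinset.2 ⟨_, hgen k, hc⟩
  have h1 := hmono.id_le (P.finite_generated_cuts.toFinset.card + 1)
  have h2 := hle (P.finite_generated_cuts.toFinset.card + 1)
  simp only [id] at h1
  omega

/-- One penalty parameter is large enough for all generated families, since these have finitely many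
vertices altogether. -/
theorem MBLP.exists_uniform_largePenalty (P : MBLP n q m) :
    ∃ T : ℝ, 0 ≤ T ∧ ∀ t, T < t → ∀ C, P.IsGenerated C → P.LargePenalty t (P.Kk C) := by
  classical
  set W : Set (Pt n q) :=
    ⋃ C ∈ (P.finite_generated_cuts.toFinset.powerset : Set (Finset (Cut n q))),
      (P.Kk C).extremePoints ℝ with hWdef
  have hW : W.Finite :=
    Set.Finite.biUnion (Finset.finite_toSet _) fun C _ => P.finite_vertices C
  obtain ⟨B, hB⟩ := (((hW.prod hW).prod (hW.prod hW)).image fun p =>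
    (P.f p.1.1 - P.f p.1.2) / (ell p.2.1 p.2.1 - ell p.2.1 p.2.2)).bddAbove
  refine ⟨max B 0, le_max_right _ _, fun t ht C hC w hw _ v hv hlt a ha b hb _ => ?_⟩
  have hmem : ∀ x ∈ (P.Kk C).extremePoints ℝ, x ∈ W := fun x hx =>
    Set.mem_iUnion₂.2 ⟨C, Finset.mem_coe.2 (Finset.mem_powerset.2 fun c hc =>
      P.finite_generated_cuts.mem_toFinset.2 ⟨C, hC, hc⟩), hx⟩
  have := hB ⟨((a, b), (w, v)), ⟨⟨hmem a ha, hmem b hb⟩, hmem w hw, hmem v hv⟩, rfl⟩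
  rw [← div_lt_iff₀ (sub_pos.2 hlt)]
  exact (this.trans (le_max_left _ _)).trans_lt ht

/-! ### Correctness of the result of a run -/

/-- The type-II cut at a critical point which is not binary removes no feasible point, if the penalty
parameter is large: `u` minimizes `f + t l_u`, hence a vertex with smaller `l_u` would have a much
larger `f`. -/
theorem MBLP.typeII_sat {P : MBLP n q m} {t : ℝ} {C : Finset (Cut n q)}
    (ht : P.LargePenalty t (P.Kk C)) {u : Pt n q} (hu : u ∈ (P.Kk C).extremePoints ℝ)
    (hcrit : P.IsCritical t (P.Kk C) u) (hS : u ∉ P.Sk C) (hc : DCConstructible u) {v : Pt n q}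
    (hv : v ∈ P.Sk C) : (typeII u).ineq.Sat v := by
  rw [P.mem_Sk_iff] at hv hS
  have hub : ¬ Binary u := fun hb => hS ⟨hu.1, hb⟩
  obtain ⟨k, hk⟩ := ell_integer_of_binary u hv.2
  simp only [typeII, dcIneq_sat]
  by_contra hlt
  rw [not_le, hk, Int.cast_lt, Int.lt_ceil, ← hk] at hlt
  obtain ⟨x, hx, hmin⟩ := P.exists_vertex_isMin ⟨u, hu.1⟩ (dcIneq u 0).a
  have hxlt : ell u x < ell u u := by
    have := hmin v hv.1
    refine lt_of_le_of_lt ?_ hlt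
    rw [ell_eq_dot, ell_eq_dot]
    linarith
  have h1 := ht u hu hub x hx hxlt x hx u hu hub
  have h2 := hcrit.isMin_linearized hc.2 hx.1
  linarith

/-- The type-I cut at a feasible critical point `u` only removes points with the `x`-part of `u`,
and `u` is a best one among these. -/
theorem MBLP.typeI_sat_or_le {P : MBLP n q m} {t : ℝ} (ht : 0 < t) {C : Finset (Cut n q)}
    {u : Pt n q} (hcrit : P.IsCritical t (P.Kk C) u) (hS : u ∈ P.Sk C) {v : Pt n q}
    (hv : v ∈ P.Sk C) : (typeI u).ineq.Sat v ∨ P.f u ≤ P.f v := by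
  rw [P.mem_Sk_iff] at hv hS
  simp only [typeI, dcIneq_sat, or_iff_not_imp_left, not_le]
  intro hlt
  obtain ⟨k, hk⟩ := ell_integer_of_binary u hv.2
  have hle : ell u v ≤ 0 := by
    rw [hk] at hlt ⊢
    have : k < 1 := by exact_mod_cast hlt
    exact_mod_cast Int.lt_add_one_iff.1 this
  have h1 := hcrit.isMin_linearized (fun i => by
    rcases hS.2 i with h | h <;> rw [h] <;> norm_num) hv.1
  have h2 := penalty_nonneg_of_mem hS.1.1
  rw [penalty_eq_ell_self] at h2
  have h3 := mul_nonneg ht.le h2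
  have h4 := mul_nonpos_of_nonneg_of_nonpos ht.le hle
  linarith

/-- The invariant of the algorithm: `uopt` is a feasible point with value `UB` (if there is one), each
feasible solution which has been cut off is no better than `UB`, and `LB` is a lower bound for the
remaining ones. -/
structure MBLP.Invariant (P : MBLP n q m) (s : State n q) : Prop where
  best : (s.UB = ⊤ ∧ s.uopt = none) ∨
    ∃ u ∈ P.S, s.uopt = some u ∧ s.fopt = some (P.f u) ∧ s.UB = (P.f u : EReal)
  kept : ∀ v ∈ P.S, v ∈ P.Sk s.cuts ∨ s.UB ≤ (P.f v : EReal)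
  bound : ∀ v ∈ P.Sk s.cuts, s.LB ≤ (P.f v : EReal)
  LB_ne_top : s.LB ≠ ⊤

theorem MBLP.invariant_start (P : MBLP n q m) : P.Invariant (start n q) where
  best := Or.inl ⟨rfl, rfl⟩
  kept v hv := Or.inl ⟨hv, by simp [start]⟩
  bound v _ := bot_le
  LB_ne_top := bot_ne_top

theorem MBLP.Invariant.updateLB {P : MBLP n q m} {s : State n q} (h : P.Invariant s) {u₀ : Pt n q}
    (hu₀ : P.SolvesRelaxation s.cuts u₀) : P.Invariant (P.updateLB s u₀) where
  best := h.best
  kept := h.kept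
  bound v hv := max_le (h.bound v hv)
    (EReal.coe_le_coe_iff.2 (hu₀.2 v ((P.mem_Sk_iff _ _).1 hv).1))
  LB_ne_top := by
    rcases max_choice s.LB (P.f u₀ : EReal) with e | e <;> simp only [MBLP.updateLB, e]
    · exact h.LB_ne_top
    · exact EReal.coe_ne_top _

theorem MBLP.Invariant.updateUB {P : MBLP n q m} {s : State n q} (h : P.Invariant s) {u : Pt n q}
    (hu : u ∈ P.S) : P.Invariant (P.updateUB s u) where
  best := by
    unfold MBLP.updateUB
    split_ifs
    · exact Or.inr ⟨u, hu, rfl, rfl, rfl⟩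
    · exact h.best
  kept v hv := by
    rw [updateUB_cuts, updateUB_UB]
    exact (h.kept v hv).imp_right (min_le_left _ _).trans
  bound := by rw [updateUB_cuts, updateUB_LB]; exact h.bound
  LB_ne_top := by rw [updateUB_LB]; exact h.LB_ne_top

theorem MBLP.Invariant.addCuts {P : MBLP n q m} {s : State n q} (h : P.Invariant s)
    {C : Finset (Cut n q)} (hsub : s.cuts ⊆ C)
    (hC : ∀ v ∈ P.Sk s.cuts, v ∈ P.Sk C ∨ s.UB ≤ (P.f v : EReal)) :
    P.Invariant { s with cuts := C } where
  best := h.best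
  kept v hv := (h.kept v hv).elim (hC v) Or.inr
  bound v hv := h.bound v ⟨hv.1, fun c hc => hv.2 c (hsub hc)⟩
  LB_ne_top := h.LB_ne_top

theorem MBLP.Step.invariant {P : MBLP n q m} {G : CutRule n q} (hG : P.IsGlobalCutRule G)
    {t ε : ℝ} (ht : 0 < t) {s s' : State n q} (h : P.Step G t ε s s') (hs : P.Invariant s)
    (hlarge : P.LargePenalty t (P.Kk s.cuts)) : P.Invariant s' := by
  classical
  obtain ⟨-, u₀, hu₀, -, u, hu, V₀, hV₀, s₁, V₁, hV₁, rfl⟩ := h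
  have huK := hu.mem_extremePoints hu₀.1
  have hs' := hs.updateLB hu₀
  have hcuts : s₁.cuts = s.cuts := by
    cases hV₁ with
    | feasible _ => exact P.updateUB_cuts _ _
    | _ => rfl
  have hs₁ : P.Invariant s₁ := by
    cases hV₁ with
    | feasible h => exact hs'.updateUB h.1
    | _ => exact hs'
  have key : ∀ v ∈ P.Sk s.cuts, (∀ c ∈ V₁, c.ineq.Sat v) ∨ s₁.UB ≤ (P.f v : EReal) := by
    intro v hv
    cases hV₁ with
    | feasible h =>
      refine (MBLP.typeI_sat_or_le ht hu.2 h hv).imp (fun h c hc => ?_) fun h => ?_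
      · rwa [Finset.mem_singleton.1 hc]
      · rw [updateUB_UB]
        exact (min_le_right _ _).trans (EReal.coe_le_coe_iff.2 h)
    | constructible h hc =>
      refine Or.inl fun c hc' => ?_
      rw [Finset.mem_singleton.1 hc']
      exact MBLP.typeII_sat hlarge huK hu.2 h hc hv
    | classical _ h hc hV => exact Or.inl fun c hc => hG _ _ _ hV c hc v hv
  refine hs₁.addCuts ?_ fun v hv => ?_
  · rw [hcuts]
    exact Finset.subset_union_left.trans Finset.subset_union_left
  · rw [hcuts] at hv
    refine (key v hv).imp_left fun h => ⟨hv.1, fun c hc => ?_⟩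
    simp only [Finset.mem_union] at hc
    rcases hc with (hc | hc) | hc
    · exact hv.2 c hc
    · exact hG _ _ _ hV₀ c hc v hv
    · exact h c hc

theorem MBLP.IsRun.invariant {P : MBLP n q m} {G : CutRule n q} (hG : P.IsGlobalCutRule G)
    {t ε : ℝ} (ht : 0 < t) {N : ℕ} {run : ℕ → State n q} (h : P.IsRun G t ε N run)
    (hlarge : ∀ k < N, P.LargePenalty t (P.Kk (run k).cuts)) :
    ∀ k ≤ N, P.Invariant (run k) := by
  intro k
  induction k with
  | zero => intro _; rw [h.1]; exact P.invariant_start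
  | succ k ih => intro hk; exact (h.2 k hk).invariant hG ht (ih (by omega)) (hlarge k hk)

/-- If nothing better than `UB` is left, the best solution found is optimal, or there is none. -/
theorem MBLP.Invariant.exact {P : MBLP n q m} {s : State n q} (h : P.Invariant s)
    (hall : ∀ v ∈ P.S, s.UB ≤ (P.f v : EReal)) :
    (s.UB = ⊤ ∧ s.uopt = none ∧ P.S = ∅) ∨
      ∃ u, s.uopt = some u ∧ s.fopt = some (P.f u) ∧ P.IsOptimal u := by
  rcases h.best with ⟨h1, h2⟩ | ⟨u, hu, h1, h2, h3⟩
  · refine Or.inl ⟨h1, h2, Set.eq_empty_of_forall_notMem fun v hv => ?_⟩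
    have := hall v hv
    rw [h1, top_le_iff] at this
    exact EReal.coe_ne_top _ this
  · refine Or.inr ⟨u, h1, h2, hu, fun v hv => ?_⟩
    have := hall v hv
    rwa [h3, EReal.coe_le_coe_iff] at this

theorem MBLP.Invariant.outcome {P : MBLP n q m} {ε : ℝ} (hε : 0 < ε) {s : State n q}
    (h : P.Invariant s) {e : Exit} {r : State n q} (hexit : P.Stops ε s e r) :
    P.Outcome ε e r := by
  cases hexit with
  | relaxationInfeasible _ hK =>
    rcases h.exact fun v hv => (h.kept v hv).resolve_left fun hv' => by
      have := ((P.mem_Sk_iff _ _).1 hv').1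
      rw [hK] at this
      exact this with ⟨-, h1, h2⟩ | h1
    · exact Or.inl ⟨rfl, h1, h2⟩
    · exact Or.inr (Or.inl ⟨Or.inl rfl, h1⟩)
  | relaxationSolved u₀ _ hu₀ hS =>
    have hinv := (h.updateLB hu₀).updateUB hS.1
    have hUB : (P.updateUB (P.updateLB s u₀) u₀).UB = min s.UB (P.f u₀) := P.updateUB_UB _ _
    rcases hinv.exact fun v hv => by
      rw [hUB]
      rcases h.kept v hv with hv' | hv'
      · exact (min_le_right _ _).trans
          (EReal.coe_le_coe_iff.2 (hu₀.2 v ((P.mem_Sk_iff _ _).1 hv').1))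
      · exact (min_le_left _ _).trans hv' with ⟨-, -, h2⟩ | h1
    · exact absurd hS.1 (by rw [h2]; exact Set.notMem_empty _)
    · exact Or.inr (Or.inl ⟨Or.inr rfl, h1⟩)
  | gapClosed hgap =>
    refine Or.inr (Or.inr ⟨rfl, ?_⟩)
    have hLB := h.LB_ne_top
    have hkept := h.kept
    have hbound := h.bound
    rcases h.best with ⟨h1, -⟩ | ⟨u, hu, h1, h2, h3⟩
    · exfalso
      rw [h1] at hgap
      -- `⊤ - LB = ⊤` needs `LB ≠ ⊤`
      induction hl : s.LB with
      | bot => rw [hl] at hgap; exact absurd hgap (by simp)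
      | top => exact hLB hl
      | coe x => rw [hl] at hgap; exact absurd hgap (by simp)
    · refine ⟨u, h1, h2, hu, h3, hgap, fun v hv => ?_⟩
      rcases hkept v hv with hv' | hv'
      · have hb := hbound v hv'
        rw [h3] at hgap
        induction hl : s.LB with
        | bot => rw [hl] at hgap; exact absurd hgap (by simp)
        | top => exact absurd hl hLB
        | coe x =>
          rw [hl] at hgap hb
          rw [← EReal.coe_sub, EReal.coe_lt_coe_iff] at hgap
          rw [EReal.coe_le_coe_iff] at hb
          linarith
      · rw [h3, EReal.coe_le_coe_iff] at hv'
        linarith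

end DCCUT

theorem mainTheorem1 {n q m : ℕ} (P : DCCUT.MBLP n q m) :
    -- whatever global cuts are used, a run which stops has one of the three outcomes
    (∀ G : DCCUT.CutRule n q, P.IsGlobalCutRule G → ∀ t ε : ℝ, 0 < t → 0 < ε →
      ∀ (N : ℕ) (run : ℕ → DCCUT.State n q), P.IsRun G t ε N run →
        (∀ k < N, P.LargePenalty t (P.Kk (run k).cuts)) →
        ∀ (e : DCCUT.Exit) (r : DCCUT.State n q), P.Stops ε (run N) e r → P.Outcome ε e r) ∧
    -- lift-and-project cuts are global cuts
    P.IsGlobalCutRule P.liftProject ∧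
    -- with lift-and-project cuts, a finite penalty parameter is large enough for all `𝒦ᵏ`
    (∃ T : ℝ, 0 ≤ T ∧ ∀ t ε : ℝ, T < t → 0 < ε →
      ∀ (N : ℕ) (run : ℕ → DCCUT.State n q), P.IsRun P.liftProject t ε N run →
        P.LargePenalty t (P.Kk (run N).cuts)) ∧
    -- with lift-and-project cuts, every run stops after finitely many iterations
    (∀ t ε : ℝ, 0 < t → 0 < ε →
      (∀ (N : ℕ) (run : ℕ → DCCUT.State n q), P.IsRun P.liftProject t ε N run →
        -- the algorithm is never blocked
        ((∃ e r, P.Stops ε (run N) e r) ∨ ∃ s', P.Step P.liftProject t ε (run N) s') ∧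
        -- every call of DCA reaches a critical point after finitely many DCA iterations
        (∀ z : ℕ → DCCUT.Pt n q, P.SolvesRelaxation (run N).cuts (z 0) →
          (∀ i, P.DCAStep t (P.Kk (run N).cuts) (z i) (z (i + 1))) →
          ∃ i, P.IsCritical t (P.Kk (run N).cuts) (z i))) ∧
      ¬ ∃ run : ℕ → DCCUT.State n q, ∀ N, P.IsRun P.liftProject t ε N run) := by
  refine ⟨?_, P.isGlobalCutRule_liftProject, ?_, fun t ε ht _ => ⟨fun N run _ => ⟨?_, ?_⟩, ?_⟩⟩
  · intro G hG t ε ht hε N run hrun hlarge e r hexit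
    exact (hrun.invariant hG ht hlarge N le_rfl).outcome hε hexit
  · obtain ⟨T, hT, h⟩ := P.exists_uniform_largePenalty
    exact ⟨T, hT, fun t ε ht _ N run hrun => h t ht _ (hrun.isGenerated N le_rfl)⟩
  · exact P.exists_step ht (run N)
  · exact fun z hz hstep => P.exists_isCritical_of_DCA z hz.1 hstep
  · exact P.not_exists_infinite_run t ε
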